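/- The Maker-Breaker domination game is played on a finite graph $G$: Dominator and Staller alternately choose an unplayed vertex until every vertex is chosen. Dominator wins if the vertices he chose form a dominating set of $G$; otherwise Staller has chosen an entire closed neighborhood, and she wins. The outcome $o(G)$ is $\mathcal D$ (resp. $\mathcal S$) if Dominator (resp. Staller) has a winning strategy both as first and as second player, $\mathcal N$ if each player has a winning strategy when starting, and $\mathcal P$ otherwise. Cographs are the graphs obtained from single vertices $K_1$ by repeatedly taking the disjoint union $G\cup H$ or the join $G\bowtie H$ (the disjoint union plus all edges between $G$ and $H$) of two cographs; an expression of this kind that builds a graph, up to isomorphism, is a cotree of it. 1. For every cograph and each of its cotrees, the outcome is given by the following recursion along the cotree. $o(K_1)=\mathcal N$. For a union, $o(G\cup H)=\mathcal S$ if $o(G)=\mathcal S$, or $o(H)=\mathcal S$, or $o(G)=o(H)=\mathcal N$; $o(G\cup H)=\mathcal D$ if $o(G)=o(H)=\mathcal D$; and $o(G\cup H)=\mathcal N$ otherwise. For a join, $o(G\bowtie H)=\mathcal N$ if one of $G,H$ is $K_1$ and the other has outcome $\mathcal S$; and $o(G\bowtie H)=\mathcal D$ otherwise. 2. The outcome of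 the Maker-Breaker domination game on cographs can be computed in polynomial time: there is a (multi-stack) Turing machine that, given the adjacency matrix of any cograph $G$ on $\{0,\dots,n-1\}$, outputs $o(G)$ after a number of steps bounded by a polynomial in the length of the input. -/

import Mathlib

namespace MBDomination

/-- The two players. -/
inductive Player where
  | dominator
  | staller

/-- The opponent of a player. -/
def Player.other : Player → Player
  | dominator => staller
  | staller => dominator

/-- The state of play on a vertex set `V`: `c v = some p` if the player `p` has chosen `v`, and
`c v = none` if `v` is unplayed. A position of the game is a graph with such a coloring. -/
abbrev Coloring (V : Type*) := V → Option Player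

/-- The starting coloring: every vertex is unplayed. -/
def Coloring.start (V : Type*) : Coloring V := fun _ => none

section Game

variable {V : Type*} (G : SimpleGraph V)

/-- `u` lies in the closed neighborhood of `v`. -/
def InClosedNbhd (u v : V) : Prop := u = v ∨ G.Adj v u

/-- The winning condition of each player, read off when no vertex is unplayed: the vertices of
Dominator form a dominating set, resp. Staller owns the closed neighborhood of some vertex. -/
def WinsFinal (c : Coloring V) : Player → Prop
  | .dominator => ∀ v, ∃ u, InClosedNbhd G u v ∧ c u = some .dominator
  | .staller => ∃ v, ∀ u, InClosedNbhd G u v → c u = some .staller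

open Classical in
/-- `HasWinningStrategy G p q c`: player `p` has a winning strategy in the Maker-Breaker
domination game on the graph `G` from the coloring `c` when `q` is the player to move. A proof is a
strategy tree: one move of `p` wherever `p` is to move, a continuation for every move of the
opponent wherever the opponent is to move, and a win for `p` whenever all vertices are played. -/
inductive HasWinningStrategy (p : Player) : Player → Coloring V → Prop
  | final {q : Player} {c : Coloring V} (hfull : ∀ v, c v ≠ none) (hwin : WinsFinal G c p) :
      HasWinningStrategy p q c
  | move {c : Coloring V} (u : V) (hu : c u = none)
      (h : HasWinningStrategy p p.other (Function.update c u (some p))) :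
      HasWinningStrategy p p c
  | reply {c : Coloring V} (hmove : ∃ u, c u = none)
      (h : ∀ u, c u = none →
        HasWinningStrategy p p (Function.update c u (some p.other))) :
      HasWinningStrategy p p.other c

end Game

/-- The four possible outcomes of a position. -/
inductive Outcome where
  | D
  | S
  | N
  | P

open Classical in
/-- The outcome of the position `(G, c)`: `D` if Dominator has a winning strategy as first and as
second player, `S` if Staller has one as first and as second player, `N` if each player has one
when starting, and `P` otherwise. -/
noncomputable def positionOutcome {V : Type*} (G : SimpleGraph V) (c : Coloring V) : Outcome :=
  if HasWinningStrategy G .dominator .dominator c ∧ HasWinningStrategy G .dominator .staller c then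
    .D
  else if HasWinningStrategy G .staller .staller c ∧ HasWinningStrategy G .staller .dominator c then
    .S
  else if HasWinningStrategy G .dominator .dominator c ∧
      HasWinningStrategy G .staller .staller c then
    .N
  else .P

/-- The outcome of a graph, viewed as a starting position. -/
noncomputable def outcome {V : Type*} (G : SimpleGraph V) : Outcome :=
  positionOutcome G (Coloring.start V)

/-- The join of two graphs: their disjoint union with all edges between the two sides. -/
def joinGraph {V W : Type*} (G : SimpleGraph V) (H : SimpleGraph W) : SimpleGraph (V ⊕ W) :=
  (G ⊕g H) ⊔ completeBipartiteGraph V W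

/-- Cotrees: expressions that build a graph from single vertices by disjoint unions and joins. -/
inductive Cotree where
  | single
  | union (s t : Cotree)
  | join (s t : Cotree)

namespace Cotree

/-- The vertex type of the graph built by a cotree. -/
def Vert : Cotree → Type
  | single => Unit
  | union s t => s.Vert ⊕ t.Vert
  | join s t => s.Vert ⊕ t.Vert

/-- The graph built by a cotree. -/
def graph : (t : Cotree) → SimpleGraph t.Vert
  | single => (⊥ : SimpleGraph Unit)
  | union s t => s.graph ⊕g t.graph
  | join s t => joinGraph s.graph t.graph

end Cotree

/-- `G` is a cograph: up to isomorphism it is built from single vertices by unions and joins. -/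
def IsCograph {V : Type*} (G : SimpleGraph V) : Prop :=
  ∃ t : Cotree, Nonempty (G ≃g t.graph)

/-- The rule for unions: `S` is absorbing, `N` with `N` gives `S`, `D` with `D` gives `D`, and
everything else gives `N`. -/
def unionRule : Outcome → Outcome → Outcome
  | .S, _ => .S
  | _, .S => .S
  | .N, .N => .S
  | .D, .D => .D
  | _, _ => .N

open Classical in
/-- The recursive evaluation of a cotree: `N` on a single vertex, the union rule on unions, and on
a join `N` if one side is a single vertex and the other side evaluates to `S`, `D` otherwise. -/
noncomputable def Cotree.eval : Cotree → Outcome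
  | single => .N
  | union s t => unionRule s.eval t.eval
  | join s t => if (s = single ∧ t.eval = .S) ∨ (t = single ∧ s.eval = .S) then .N else .D

/-- The instances of the decision problem: cographs with vertex set `{0, …, n - 1}`. -/
abbrev CographInstance := {G : Σ n : ℕ, SimpleGraph (Fin n) // IsCograph G.2}

open Classical in
/-- The input word of a graph on `{0, …, n - 1}`: the rows of its adjacency matrix, one symbol
`some b` per entry, each row followed by the end-of-row symbol `none`. -/
noncomputable def encodeGraph {n : ℕ} (G : SimpleGraph (Fin n)) : List (Option Bool) :=
  (List.finRange n).flatMap fun i =>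
    ((List.finRange n).map fun j => some (decide (G.Adj i j))) ++ [none]

/-- The input word of an instance. -/
noncomputable def encodeInstance (G : CographInstance) : List (Option Bool) :=
  encodeGraph G.1.2

/-- The output word of an outcome: a single symbol. -/
def encodeOutcome (o : Outcome) : List Outcome := [o]

end MBDomination

/-!
The proof has two independent parts.

*The recursion.* `StallerWins` describes the positions won by Staller, with the play stopped as soon
as she owns a closed neighborhood. It is monotone in the coloring, and having the move never hurts
(`StallerWins.mono`, `StallerWins.staller`); by determinacy (`hasWinningStrategy_iff`) the outcome
of a graph only depends on whether Staller wins as first and as second player. On a union, Staller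
wins exactly if she wins on one side, or if she moves second and wins on both sides when starting
there: wherever Dominator plays, she starts on the other side. On a join with at least two vertices
on each side, Dominator secures one vertex on each side, and any two such vertices dominate
everything. On the join of one vertex with `H`, Dominator wins if he gets the universal vertex, so
Staller has to start there, and the play continues on `H` with Dominator to move.

*The algorithm.* By the recursion a connected cograph with more than one vertex has outcome `N` if
it has a universal vertex whose removal leaves a graph of outcome `S`, and outcome `D` otherwise;
and a graph has outcome `S`, `N` or `D` according to whether at least two, exactly one or none of
its components have outcome `N`. Comparing closed neighborhoods, this can be said without mentioning
components: `MarkStep` marks a vertex if it is comparable to all its neighbors and has nothing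
below it or covers two marked vertices, and after as many rounds as there are vertices, the marked
vertices with nothing above them are the universal vertices of the components of outcome `N`, so
counting them gives the outcome (`Cotree.rootOutcome_graph`). One round is a first-order definition over the graph and the set of
marked vertices.

To evaluate first-order formulas on a stack machine, the adjacency matrix is kept as a word whose
letters also record which variables have the row or column at hand as their value. Atomic formulas
are then tested, and variables moved to the next vertex, by letting a finite transducer sweep over
the word. `SweepProgram.Prog` is a small programming language whose basic instruction is such a
sweep; it is compiled to `Turing.FinTM2` with an exact count of steps (`steps_of_exec`,
`computableInPolyTime`), and quantifiers become loops (`exec_exProg`, `Fml.exec_check`), so that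
each formula is evaluated within polynomial time.
-/

namespace MBDomination

/-! ### Staller's winning positions -/

/-- `StallerWins G q c`: Staller wins from the coloring `c` when `q` is to move, where the play may
stop as soon as Staller owns a closed neighborhood. Dominator's winning positions are the
complement. -/
inductive StallerWins {V : Type*} [DecidableEq V] (G : SimpleGraph V) : Player → Coloring V → Prop
  | done {q : Player} {c : Coloring V} (v : V)
      (hv : ∀ u, InClosedNbhd G u v → c u = some .staller) : StallerWins G q c
  | move {c : Coloring V} (u : V) (hu : c u = none)
      (h : StallerWins G .dominator (Function.update c u (some .staller))) :
      StallerWins G .staller c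
  | reply {c : Coloring V} (w : V) (hw : c w = none)
      (h : ∀ u, c u = none →
        StallerWins G .staller (Function.update c u (some .dominator))) :
      StallerWins G .dominator c

/-- `AtLeast c d`: the coloring `d` is at least as good for Staller as `c`, for the order
`dominator < unplayed < staller` at each vertex. -/
def AtLeast {V : Type*} (c d : Coloring V) : Prop :=
  ∀ v, (c v = some .staller → d v = some .staller) ∧
    (d v = some .dominator → c v = some .dominator)

lemma AtLeast.refl {V : Type*} (c : Coloring V) : AtLeast c c := fun _ => ⟨id, id⟩

section

variable {V : Type*} [DecidableEq V] {G : SimpleGraph V}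

lemma AtLeast.update {c d : Coloring V} (h : AtLeast c d) (u : V) (o : Option Player) :
    AtLeast (Function.update c u o) (Function.update d u o) := by
  intro v
  by_cases hv : v = u
  · subst hv; simp
  · simpa [hv] using h v

lemma AtLeast.update_left {c d : Coloring V} (h : AtLeast c d) (u : V)  :
    AtLeast (Function.update c u (some .dominator)) d := by
  intro v
  by_cases hv : v = u
  · subst hv; simp
  · simpa [hv] using h v

lemma AtLeast.update_staller {c d : Coloring V} (h : AtLeast c d) {u : V}
    (hu : d u = some .staller) : AtLeast (Function.update c u (some .staller)) d := by
  intro v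
  by_cases hv : v = u
  · subst hv; simp [hu]
  · simpa [hv] using h v

lemma AtLeast.update_dominator {c d : Coloring V} (h : AtLeast c d) {u : V}
    (hu : c u = some .dominator) : AtLeast c (Function.update d u (some .dominator)) := by
  intro v
  by_cases hv : v = u
  · subst hv; simp [hu]
  · simpa [hv] using h v

lemma StallerWins.of_full {q q' : Player} {c : Coloring V} (h : StallerWins G q c)
    (hc : ∀ v, c v ≠ none) : StallerWins G q' c := by
  cases h with
  | done v hv => exact .done v hv
  | move u hu _ => exact absurd hu (hc u)
  | reply w hw _ => exact absurd hw (hc w)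

/-- Improving the coloring for Staller, or handing her the move, does not hurt her. -/
lemma StallerWins.mono_aux {q : Player} {c : Coloring V} (h : StallerWins G q c) :
    ∀ d, AtLeast c d → StallerWins G q d ∧ StallerWins G .staller d := by
  induction h with
  | done v hv =>
    intro d hd
    have : ∀ u, InClosedNbhd G u v → d u = some .staller := fun u hu => (hd u).1 (hv u hu)
    exact ⟨.done v this, .done v this⟩
  | @move c u hu h ih =>
    intro d hd
    suffices StallerWins G .staller d from ⟨this, this⟩
    match hdu : d u with
    | none => exact .move u hdu (ih _ (hd.update u _)).1
    | some .staller => exact (ih d (hd.update_staller hdu)).2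
    | some .dominator => simp [(hd u).2 hdu] at hu
  | @reply c w hw h ih =>
    intro d hd
    have key : ∀ e, AtLeast c e → StallerWins G .staller e := fun e he =>
      (ih w hw e (he.update_left w)).2
    refine ⟨?_, key d hd⟩
    by_cases hfull : ∀ v, d v ≠ none
    · exact (key d hd).of_full hfull
    · push Not at hfull
      obtain ⟨y, hy⟩ := hfull
      refine .reply y hy fun u hu => ?_
      match hcu : c u with
      | none => exact (ih u hcu _ (hd.update u _)).1
      | some .dominator => exact key _ (hd.update_dominator hcu)
      | some .staller => simp [(hd u).1 hcu] at hu

lemma StallerWins.mono {q : Player} {c d : Coloring V} (h : StallerWins G q c)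
    (hd : AtLeast c d) : StallerWins G q d := (h.mono_aux d hd).1

/-- Moving first is no disadvantage. -/
lemma StallerWins.staller {q : Player} {c : Coloring V} (h : StallerWins G q c) :
    StallerWins G .staller c := (h.mono_aux c (.refl c)).2

/-- The positions are determined: exactly one player has a winning strategy, and it is Staller
exactly in the positions of `StallerWins`. -/
lemma hasWinningStrategy_iff [Fintype V] (q : Player) (c : Coloring V) :
    (HasWinningStrategy G .staller q c ↔ StallerWins G q c) ∧
      (HasWinningStrategy G .dominator q c ↔ ¬ StallerWins G q c) := by
  classical
  induction hn : (Finset.univ.filter fun v => c v = none).card using Nat.strong_induction_on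
    generalizing q c with
  | _ n ih =>
  have ih' : ∀ (q : Player) (u : V) (hu : c u = none) (o : Player),
      (HasWinningStrategy G .staller q (Function.update c u (some o)) ↔
        StallerWins G q (Function.update c u (some o))) ∧
      (HasWinningStrategy G .dominator q (Function.update c u (some o)) ↔
        ¬ StallerWins G q (Function.update c u (some o))) := by
    intro q u hu o
    refine ih _ ?_ q _ rfl
    rw [← hn]
    apply Finset.card_lt_card
    refine ⟨fun v hv => ?_, fun hs => ?_⟩
    · by_cases hvu : v = u
      · subst hvu; simp at hv
      · simpa [hvu] using hv
    · have := hs (by simpa using hu : u ∈ _)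
      simp at this
  have dec : (fun a b => Classical.propDecidable (a = b)) = (inferInstance : DecidableEq V) :=
    Subsingleton.elim _ _
  by_cases hfull : ∀ v, c v ≠ none
  · have hW : StallerWins G q c ↔ WinsFinal G c .staller := by
      constructor
      · intro h
        cases h with
        | done v hv => exact ⟨v, hv⟩
        | move u hu _ => exact absurd hu (hfull u)
        | reply w hw _ => exact absurd hw (hfull w)
      · rintro ⟨v, hv⟩; exact .done v hv
    have hD : WinsFinal G c .dominator ↔ ¬ WinsFinal G c .staller := by
      simp only [WinsFinal, not_exists, not_forall]
      refine forall_congr' fun v => exists_congr fun u => ?_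
      have := hfull u
      match hcu : c u with
      | none => exact absurd hcu this
      | some .dominator => simp
      | some .staller => simp
    have hF : ∀ p, HasWinningStrategy G p q c ↔ WinsFinal G c p := by
      intro p
      constructor
      · intro h
        cases h with
        | final _ h => exact h
        | move u hu _ => exact absurd hu (hfull u)
        | reply hw _ => exact absurd hw.choose_spec (hfull _)
      · exact .final hfull
    rw [hF, hF, hW, hD]
    simp
  · have hex : ∃ u, c u = none := by push Not at hfull; exact hfull
    -- the rules of the game, with the play not finished
    have own : ∀ p, HasWinningStrategy G p p c ↔
        ∃ u, c u = none ∧ HasWinningStrategy G p p.other (Function.update c u (some p)) := by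
      intro p
      constructor
      · intro h
        obtain ⟨q, hq, h⟩ : ∃ q, p = q ∧ HasWinningStrategy G p q c := ⟨p, rfl, h⟩
        cases h with
        | final h _ => exact absurd h hfull
        | move u hu h => rw [dec] at h; exact ⟨u, hu, h⟩
        | reply _ _ => cases p <;> cases hq
      · rintro ⟨u, hu, h⟩; exact .move u hu (by rw [dec]; exact h)
    have opp : ∀ p, HasWinningStrategy G p p.other c ↔
        ∀ u, c u = none → HasWinningStrategy G p p (Function.update c u (some p.other)) := by
      intro p
      constructor
      · intro h
        generalize hq : p.other = q at h
        cases h with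
        | final h _ => exact absurd h hfull
        | move u hu h => cases p <;> cases hq
        | reply _ h => rw [dec] at h; exact h
      · intro h; exact .reply hex (by rw [dec]; exact h)
    have hS : StallerWins G .staller c ↔
        ∃ u, c u = none ∧ StallerWins G .dominator (Function.update c u (some .staller)) := by
      constructor
      · intro h
        cases h with
        | done v hv =>
          obtain ⟨u, hu⟩ := hex
          refine ⟨u, hu, .done v fun w hw => ?_⟩
          by_cases hwu : w = u
          · subst hwu; simp
          · simpa [hwu] using hv w hw
        | move u hu h => exact ⟨u, hu, h⟩
      · rintro ⟨u, hu, h⟩; exact .move u hu h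
    have hD : StallerWins G .dominator c ↔
        ∀ u, c u = none → StallerWins G .staller (Function.update c u (some .dominator)) := by
      constructor
      · intro h
        cases h with
        | done v hv =>
          intro u hu
          refine .done v fun w hw => ?_
          by_cases hwu : w = u
          · subst hwu; exact absurd (hv w hw) (by simp [hu])
          · simpa [hwu] using hv w hw
        | reply _ _ h => exact h
      · intro h; obtain ⟨u, hu⟩ := hex; exact .reply u hu h
    cases q with
    | staller =>
      have h1 := own .staller
      have h2 := opp .dominator
      simp only [Player.other] at h1 h2
      rw [h1, h2, hS]
      constructor
      · exact exists_congr fun u => and_congr_right fun hu => (ih' _ u hu _).1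
      · push Not
        exact forall_congr' fun u => imp_congr_right fun hu => (ih' _ u hu _).2
    | dominator =>
      have h1 := own .dominator
      have h2 := opp .staller
      simp only [Player.other] at h1 h2
      rw [h1, h2, hD]
      constructor
      · exact forall_congr' fun u => imp_congr_right fun hu => (ih' _ u hu _).1
      · push Not
        exact exists_congr fun u => and_congr_right fun hu => (ih' _ u hu _).2

open Classical in
lemma outcome_eq [Fintype V] : outcome G =
    if StallerWins G .dominator (Coloring.start V) then .S
    else if StallerWins G .staller (Coloring.start V) then .N else .D := by
  unfold outcome positionOutcome
  simp only [hasWinningStrategy_iff]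
  have := fun h : StallerWins G .dominator (Coloring.start V) => h.staller
  split_ifs <;> tauto

lemma StallerWins.map {W : Type*} [DecidableEq W] {H : SimpleGraph W} (e : G ≃g H) {q : Player}
    {c : Coloring V} (h : StallerWins G q c) : StallerWins H q (c ∘ e.symm) := by
  have upd : ∀ (c : Coloring V) u o, Function.update c u o ∘ e.symm =
      Function.update (c ∘ e.symm) (e u) o := by
    intro c u o
    ext1 w
    by_cases hw : w = e u
    · subst hw; simp
    · have : e.symm w ≠ u := fun h => hw (by simp [← h])
      simp [hw, this]
  induction h with
  | done v hv =>
    refine .done (e v) fun u hu => hv _ ?_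
    rcases hu with hu | hu
    · left; simp [hu]
    · right; rw [← e.map_adj_iff]; simpa using hu
  | move u hu _ ih => exact .move (e u) (by simpa using hu) (by rw [← upd]; exact ih)
  | reply w hw _ ih =>
    refine .reply (e w) (by simpa using hw) fun u hu => ?_
    have := ih (e.symm u) hu
    rw [upd] at this
    simpa using this

lemma stallerWins_iso {W : Type*} [DecidableEq W] {H : SimpleGraph W} (e : G ≃g H) (q : Player) :
    StallerWins G q (Coloring.start V) ↔ StallerWins H q (Coloring.start W) :=
  ⟨fun h => h.map e, fun h => h.map e.symm⟩

lemma outcome_iso [Fintype V] {W : Type*} [Fintype W] {H : SimpleGraph W} (e : G ≃g H) :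
    outcome G = outcome H := by
  classical
  simp only [outcome_eq, stallerWins_iso e]

end

/-! ### Closed neighborhoods in unions and joins -/

section

variable {V W : Type*} {G : SimpleGraph V} {H : SimpleGraph W}

@[simp] lemma inClosedNbhd_union_inl_inl {u v : V} :
    InClosedNbhd (G ⊕g H) (.inl u) (.inl v) ↔ InClosedNbhd G u v := by simp [InClosedNbhd]

@[simp] lemma inClosedNbhd_union_inr_inr {u v : W} :
    InClosedNbhd (G ⊕g H) (.inr u) (.inr v) ↔ InClosedNbhd H u v := by simp [InClosedNbhd]

@[simp] lemma inClosedNbhd_union_inl_inr {u : V} {v : W} :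
    ¬ InClosedNbhd (G ⊕g H) (.inl u) (.inr v) := by simp [InClosedNbhd]

@[simp] lemma inClosedNbhd_union_inr_inl {u : W} {v : V} :
    ¬ InClosedNbhd (G ⊕g H) (.inr u) (.inl v) := by simp [InClosedNbhd]

@[simp] lemma joinGraph_adj_inl_inl {u v : V} :
    (joinGraph G H).Adj (.inl u) (.inl v) ↔ G.Adj u v := by simp [joinGraph]

@[simp] lemma joinGraph_adj_inr_inr {u v : W} :
    (joinGraph G H).Adj (.inr u) (.inr v) ↔ H.Adj u v := by simp [joinGraph]

@[simp] lemma joinGraph_adj_inl_inr {u : V} {v : W} :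
    (joinGraph G H).Adj (.inl u) (.inr v) := by simp [joinGraph]

@[simp] lemma joinGraph_adj_inr_inl {u : W} {v : V} :
    (joinGraph G H).Adj (.inr u) (.inl v) := by simp [joinGraph]

@[simp] lemma inClosedNbhd_join_inl_inl {u v : V} :
    InClosedNbhd (joinGraph G H) (.inl u) (.inl v) ↔ InClosedNbhd G u v := by simp [InClosedNbhd]

@[simp] lemma inClosedNbhd_join_inr_inr {u v : W} :
    InClosedNbhd (joinGraph G H) (.inr u) (.inr v) ↔ InClosedNbhd H u v := by simp [InClosedNbhd]

@[simp] lemma inClosedNbhd_join_inl_inr {u : V} {v : W} :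
    InClosedNbhd (joinGraph G H) (.inl u) (.inr v) := by simp [InClosedNbhd]

@[simp] lemma inClosedNbhd_join_inr_inl {u : W} {v : V} :
    InClosedNbhd (joinGraph G H) (.inr u) (.inl v) := by simp [InClosedNbhd]

/-- The join is commutative up to isomorphism. -/
def joinComm (G : SimpleGraph V) (H : SimpleGraph W) : joinGraph G H ≃g joinGraph H G where
  toEquiv := Equiv.sumComm V W
  map_rel_iff' := by rintro (u | u) (v | v) <;> simp

/-- The disjoint union is commutative up to isomorphism. -/
def unionComm (G : SimpleGraph V) (H : SimpleGraph W) : (G ⊕g H) ≃g (H ⊕g G) where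
  toEquiv := Equiv.sumComm V W
  map_rel_iff' := by rintro (u | u) (v | v) <;> simp

/-! ### The game on unions -/

variable [DecidableEq V] [DecidableEq W]

lemma StallerWins.union_inl {q : Player} {c : Coloring V} (h : StallerWins G q c) :
    ∀ e : Coloring (V ⊕ W), e ∘ Sum.inl = c → StallerWins (G ⊕g H) q e := by
  induction h with
  | done v hv =>
    rintro e rfl
    refine .done (.inl v) ?_
    rintro (u | u) hu
    · exact hv u (by simpa using hu)
    · simp at hu
  | move u hu h ih =>
    rintro e rfl
    exact .move (.inl u) hu (ih _ (by rw [Sum.update_inl_comp_inl]))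
  | reply w hw h ih =>
    rintro e rfl
    refine .reply (.inl w) hw ?_
    rintro (u | u) hu
    · exact ih u hu _ (by rw [Sum.update_inl_comp_inl])
    · -- a move of Dominator in the other component is no better than one at `inl w`
      refine StallerWins.mono (ih w hw (Function.update (Function.update e (.inr u)
        (some .dominator)) (.inl w) (some .dominator)) ?_) ((AtLeast.refl _).update_left _)
      rw [Sum.update_inl_comp_inl, Sum.update_inr_comp_inl]

lemma StallerWins.union_inr {q : Player} {e : Coloring (V ⊕ W)}
    (h : StallerWins H q (e ∘ Sum.inr)) : StallerWins (G ⊕g H) q e := by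
  have := (h.union_inl (H := G) (e ∘ Sum.swap) rfl).map (unionComm H G)
  convert this using 1
  ext1 (v | v) <;> rfl

/-- If Staller wins a union, she already wins on one side, or, moving second, she wins on both
sides when starting there. -/
lemma StallerWins.of_union {q : Player} {e : Coloring (V ⊕ W)} (h : StallerWins (G ⊕g H) q e) :
    StallerWins G q (e ∘ Sum.inl) ∨ StallerWins H q (e ∘ Sum.inr) ∨
      (q = .dominator ∧ StallerWins G .staller (e ∘ Sum.inl) ∧
        StallerWins H .staller (e ∘ Sum.inr)) := by
  induction h with
  | done v hv =>
    rcases v with v | v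
    · exact .inl (.done v fun u hu => hv (.inl u) (by simpa using hu))
    · exact .inr (.inl (.done v fun u hu => hv (.inr u) (by simpa using hu)))
  | move u hu h ih =>
    rcases u with u | u
    · rw [Sum.update_inl_comp_inl, Sum.update_inl_comp_inr] at ih
      rcases ih with ih | ih | ih
      · exact .inl (.move u hu ih)
      · exact .inr (.inl ih.staller)
      · exact .inr (.inl ih.2.2)
    · rw [Sum.update_inr_comp_inl, Sum.update_inr_comp_inr] at ih
      rcases ih with ih | ih | ih
      · exact .inl ih.staller
      · exact .inr (.inl (.move u hu ih))
      · exact .inl ih.2.1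
  | @reply e w hw h ih =>
    by_contra hcon
    push Not at hcon
    obtain ⟨hl, hr, hlr⟩ := hcon
    have hlr := hlr rfl
    -- a free vertex on one side gives Dominator a good move there
    have Hl : ∀ v, e (.inl v) = none → StallerWins H .staller (e ∘ Sum.inr) := by
      intro v hv
      by_contra hcon
      refine hl (.reply v hv fun u hu => ?_)
      have := ih (.inl u) hu
      rw [Sum.update_inl_comp_inl, Sum.update_inl_comp_inr] at this
      simpa [hcon] using this
    have Hr : ∀ v, e (.inr v) = none → StallerWins G .staller (e ∘ Sum.inl) := by
      intro v hv
      by_contra hcon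
      refine hr (.reply v hv fun u hu => ?_)
      have := ih (.inr u) hu
      rw [Sum.update_inr_comp_inl, Sum.update_inr_comp_inr] at this
      simpa [hcon] using this
    rcases w with w | w
    · have h1 := Hl w hw
      by_cases hfull : ∀ v, e (.inr v) ≠ none
      · exact hr (h1.of_full hfull)
      · push Not at hfull
        obtain ⟨v, hv⟩ := hfull
        exact hlr (Hr v hv) h1
    · have h1 := Hr w hw
      by_cases hfull : ∀ v, e (.inl v) ≠ none
      · exact hl (h1.of_full hfull)
      · push Not at hfull
        obtain ⟨v, hv⟩ := hfull
        exact hlr h1 (Hl v hv)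

lemma stallerWins_union_staller :
    StallerWins (G ⊕g H) .staller (Coloring.start (V ⊕ W)) ↔
      StallerWins G .staller (Coloring.start V) ∨ StallerWins H .staller (Coloring.start W) := by
  constructor
  · intro h
    rcases h.of_union with h | h | h
    · exact .inl h
    · exact .inr h
    · simp at h
  · rintro (h | h)
    · exact h.union_inl _ rfl
    · exact StallerWins.union_inr h

lemma stallerWins_union_dominator [Nonempty V] :
    StallerWins (G ⊕g H) .dominator (Coloring.start (V ⊕ W)) ↔
      StallerWins G .dominator (Coloring.start V) ∨ StallerWins H .dominator (Coloring.start W) ∨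
      (StallerWins G .staller (Coloring.start V) ∧ StallerWins H .staller (Coloring.start W)) := by
  constructor
  · intro h
    rcases h.of_union with h | h | h
    · exact .inl h
    · exact .inr (.inl h)
    · exact .inr (.inr h.2)
  · rintro (h | h | ⟨h, h'⟩)
    · exact h.union_inl _ rfl
    · exact StallerWins.union_inr h
    · obtain ⟨v⟩ := ‹Nonempty V›
      refine .reply (.inl v) rfl ?_
      -- Staller starts on the side where Dominator did not play
      rintro (u | u) _
      · refine StallerWins.union_inr ?_
        rw [Sum.update_inl_comp_inr]; exact h'
      · refine h.union_inl _ ?_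
        rw [Sum.update_inr_comp_inl]; rfl

/-! ### The game on joins -/

/-- Dominator owns a vertex, or can take one now. -/
def OwnsOrMoves {V : Type*} (c : Coloring V) : Prop :=
  (∃ v, c v = some .dominator) ∨ ∃ v, c v = none

/-- Dominator owns a vertex, or can still take one after a move of Staller. -/
def OwnsOrReplies {V : Type*} (c : Coloring V) : Prop :=
  (∃ v, c v = some .dominator) ∨ ∃ u v, u ≠ v ∧ c u = none ∧ c v = none

lemma OwnsOrReplies.ownsOrMoves {V : Type*} {c : Coloring V} (h : OwnsOrReplies c) : OwnsOrMoves c :=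
  h.imp id fun ⟨u, _, _, hu, _⟩ => ⟨u, hu⟩

lemma OwnsOrReplies.update {c : Coloring V} (h : OwnsOrReplies c) {w : V} (hw : c w = none) :
    OwnsOrMoves (Function.update c w (some .staller)) := by
  rcases h with ⟨v, hv⟩ | ⟨u, v, huv, hu, hv⟩
  · exact .inl ⟨v, by rwa [Function.update_of_ne (by rintro rfl; simp [hw] at hv)]⟩
  · by_cases h : u = w
    · exact .inr ⟨v, by rwa [Function.update_of_ne (by rintro rfl; exact huv h)]⟩
    · exact .inr ⟨u, by rwa [Function.update_of_ne h]⟩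

lemma ownsOrReplies_update (c : Coloring V) (w : V) :
    OwnsOrReplies (Function.update c w (some .dominator)) := .inl ⟨w, by simp⟩

lemma OwnsOrMoves.exists_update {V : Type*} {c : Coloring V} (h : OwnsOrMoves c) :
    OwnsOrReplies c ∨ ∃ w, c w = none := h.imp .inl id

/-- A vertex of Dominator on each side of a join dominates everything, so Dominator wins as soon
as he can secure one vertex on each side. -/
lemma StallerWins.of_join {q : Player} {e : Coloring (V ⊕ W)}
    (h : StallerWins (joinGraph G H) q e) :
    ¬ (OwnsOrReplies (e ∘ Sum.inl) ∧ OwnsOrReplies (e ∘ Sum.inr)) ∧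
      (q = .dominator → ¬ (OwnsOrMoves (e ∘ Sum.inl) ∧ OwnsOrReplies (e ∘ Sum.inr)) ∧
        ¬ (OwnsOrReplies (e ∘ Sum.inl) ∧ OwnsOrMoves (e ∘ Sum.inr))) := by
  induction h with
  | @done q e v hv =>
    suffices ¬ (OwnsOrMoves (e ∘ Sum.inl) ∧ OwnsOrMoves (e ∘ Sum.inr)) from
      ⟨fun h => this ⟨h.1.ownsOrMoves, h.2.ownsOrMoves⟩, fun _ =>
        ⟨fun h => this ⟨h.1, h.2.ownsOrMoves⟩, fun h => this ⟨h.1.ownsOrMoves, h.2⟩⟩⟩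
    rintro ⟨hl, hr⟩
    rcases v with v | v
    · rcases hr with ⟨w, hw⟩ | ⟨w, hw⟩ <;> simp [hv (.inr w) (by simp)] at hw
    · rcases hl with ⟨w, hw⟩ | ⟨w, hw⟩ <;> simp [hv (.inl w) (by simp)] at hw
  | move u hu h ih =>
    refine ⟨fun ⟨hl, hr⟩ => ?_, by simp⟩
    have ih := ih.2 rfl
    rcases u with u | u
    · rw [Sum.update_inl_comp_inl, Sum.update_inl_comp_inr] at ih
      exact ih.1 ⟨hl.update hu, hr⟩
    · rw [Sum.update_inr_comp_inl, Sum.update_inr_comp_inr] at ih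
      exact ih.2 ⟨hl, hr.update hu⟩
  | @reply e w hw h ih =>
    have L : ∀ u, e (.inl u) = none → ¬ OwnsOrReplies (e ∘ Sum.inr) := by
      intro u hu hr
      have := (ih (.inl u) hu).1
      rw [Sum.update_inl_comp_inl, Sum.update_inl_comp_inr] at this
      exact this ⟨ownsOrReplies_update _ _, hr⟩
    have R : ∀ u, e (.inr u) = none → ¬ OwnsOrReplies (e ∘ Sum.inl) := by
      intro u hu hl
      have := (ih (.inr u) hu).1
      rw [Sum.update_inr_comp_inl, Sum.update_inr_comp_inr] at this
      exact this ⟨hl, ownsOrReplies_update _ _⟩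
    have B : ¬ (OwnsOrReplies (e ∘ Sum.inl) ∧ OwnsOrReplies (e ∘ Sum.inr)) := by
      rintro ⟨hl, hr⟩
      rcases w with w | w
      · exact L w hw hr
      · exact R w hw hl
    refine ⟨B, fun _ => ⟨?_, ?_⟩⟩
    · rintro ⟨hl, hr⟩
      rcases hl.exists_update with hl | ⟨u, hu⟩
      · exact B ⟨hl, hr⟩
      · exact L u hu hr
    · rintro ⟨hl, hr⟩
      rcases hr.exists_update with hr | ⟨u, hu⟩
      · exact B ⟨hl, hr⟩
      · exact R u hu hl

lemma ownsOrReplies_start {V : Type*} [Nontrivial V] : OwnsOrReplies (Coloring.start V) := by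
  obtain ⟨u, v, h⟩ := exists_pair_ne V
  exact .inr ⟨u, v, h, rfl, rfl⟩

lemma not_stallerWins_join [Nontrivial V] [Nontrivial W] (q : Player) :
    ¬ StallerWins (joinGraph G H) q (Coloring.start (V ⊕ W)) :=
  fun h => h.staller.of_join.1 ⟨ownsOrReplies_start, ownsOrReplies_start⟩

/-- Dominator wins once he owns a universal vertex. -/
lemma StallerWins.universal_ne_dominator {q : Player} {c : Coloring V} {u : V}
    (hu : ∀ v, InClosedNbhd G u v) (h : StallerWins G q c) : c u ≠ some .dominator := by
  induction h with
  | done v hv => simp [hv u (hu v)]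
  | move w hw h ih =>
    by_cases h : u = w
    · subst h; simp [hw]
    · simpa [h] using ih
  | reply w hw h ih =>
    by_cases h : u = w
    · subst h; simp [hw]
    · simpa [h] using ih w hw

/-- Once Staller owns the universal vertex of `K₁ ⋈ H`, the play is that on `H`. -/
lemma StallerWins.of_universal_join [Nonempty W] {K : SimpleGraph Unit} {q : Player}
    {e : Coloring (Unit ⊕ W)} (h : StallerWins (joinGraph K H) q e)
    (he : e (.inl ()) = some .staller) : StallerWins H q (e ∘ Sum.inr) := by
  induction h with
  | @done q e v hv =>
    rcases v with v | v
    · obtain ⟨w⟩ := ‹Nonempty W›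
      exact .done w fun u _ => hv (.inr u) (by simp)
    · exact .done v fun u hu => hv (.inr u) (by simpa using hu)
  | move u hu h ih =>
    rcases u with u | u
    · simp [he] at hu
    · rw [Sum.update_inr_comp_inr] at ih
      exact .move u hu (ih (by simpa using he))
  | reply w hw h ih =>
    rcases w with w | w
    · simp [he] at hw
    · refine .reply w hw fun u hu => ?_
      have := ih (.inr u) hu (by simpa using he)
      rwa [Sum.update_inr_comp_inr] at this

lemma StallerWins.universal_join {K : SimpleGraph Unit} {q : Player}
    {c : Coloring W} (h : StallerWins H q c) : ∀ e : Coloring (Unit ⊕ W),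
      e (.inl ()) = some .staller → e ∘ Sum.inr = c → StallerWins (joinGraph K H) q e := by
  induction h with
  | done v hv =>
    rintro e he rfl
    refine .done (.inr v) ?_
    rintro (u | u) hu
    · exact he
    · exact hv u (by simpa using hu)
  | move u hu h ih =>
    rintro e he rfl
    exact .move (.inr u) hu (ih _ (by simpa using he) (by rw [Sum.update_inr_comp_inr]))
  | reply w hw h ih =>
    rintro e he rfl
    refine .reply (.inr w) hw ?_
    rintro (u | u) hu
    · simp [he] at hu
    · exact ih u hu _ (by simpa using he) (by rw [Sum.update_inr_comp_inr])

lemma not_stallerWins_universal_join_dominator [Nonempty W] {K : SimpleGraph Unit} :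
    ¬ StallerWins (joinGraph K H) .dominator (Coloring.start (Unit ⊕ W)) := by
  intro h
  cases h with
  | done v hv => simpa [Coloring.start] using hv v (.inl rfl)
  | reply w hw h =>
    refine (h (.inl ()) rfl).universal_ne_dominator (u := .inl ()) ?_ (by simp)
    rintro (v | v)
    · exact .inl rfl
    · simp

lemma stallerWins_universal_join_staller [Nonempty W] {K : SimpleGraph Unit} :
    StallerWins (joinGraph K H) .staller (Coloring.start (Unit ⊕ W)) ↔
      StallerWins H .dominator (Coloring.start W) := by
  constructor
  · intro h
    cases h with
    | done v hv => simpa [Coloring.start] using hv v (.inl rfl)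
    | move u hu h =>
      rcases u with u | u
      · have := h.of_universal_join (by simp)
        rwa [Sum.update_inl_comp_inr] at this
      · -- Dominator answers any other move by taking the universal vertex
        exfalso
        cases h with
        | done v hv =>
          have := hv (.inl ()) (by rcases v with v | v; exacts [.inl rfl, by simp])
          simp [Coloring.start] at this
        | reply w hw h =>
          refine (h (.inl ()) (by simp [Coloring.start])).universal_ne_dominator
            (u := .inl ()) ?_ (by simp)
          rintro (v | v)
          · exact .inl rfl
          · simp
  · intro h
    refine .move (.inl ()) rfl (h.universal_join _ (by simp) ?_)
    rw [Sum.update_inl_comp_inr]; rfl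

end

/-! ### The outcome of a cotree -/

lemma outcome_unit (K : SimpleGraph Unit) : outcome K = .N := by
  classical
  rw [outcome_eq, if_neg, if_pos]
  · exact .move () rfl (.done () fun _ _ => by simp)
  · intro h
    cases h with
    | done v hv => simpa [Coloring.start] using hv v (.inl rfl)
    | reply w hw h =>
      exact (h () rfl).universal_ne_dominator (u := ()) (fun _ => .inl rfl) (by simp)

section

variable {V W : Type*} [Fintype V] [Fintype W]

lemma outcome_union [Nonempty V] (G : SimpleGraph V) (H : SimpleGraph W) :
    outcome (G ⊕g H) = unionRule (outcome G) (outcome H) := by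
  classical
  have hs := @StallerWins.staller _ _ G .dominator (Coloring.start _)
  have ht := @StallerWins.staller _ _ H .dominator (Coloring.start _)
  rw [outcome_eq, stallerWins_union_staller, stallerWins_union_dominator, outcome_eq (G := G),
    outcome_eq (G := H)]
  split_ifs <;> first | rfl | (exfalso; tauto)

open Classical in
lemma outcome_universal_join [Nonempty W] (K : SimpleGraph Unit) (H : SimpleGraph W) :
    outcome (joinGraph K H) = if outcome H = .S then .N else .D := by
  rw [outcome_eq, if_neg not_stallerWins_universal_join_dominator,
    stallerWins_universal_join_staller, outcome_eq (G := H)]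
  split_ifs <;> simp_all

lemma outcome_join (G : SimpleGraph V) (H : SimpleGraph W) [Nontrivial V] [Nontrivial W] :
    outcome (joinGraph G H) = .D := by
  classical
  rw [outcome_eq, if_neg (not_stallerWins_join _), if_neg (not_stallerWins_join _)]

end

namespace Cotree

instance fintypeVert : (t : Cotree) → Fintype t.Vert
  | single => inferInstanceAs (Fintype Unit)
  | union s t =>
    letI := fintypeVert s
    letI := fintypeVert t
    inferInstanceAs (Fintype (s.Vert ⊕ t.Vert))
  | join s t =>
    letI := fintypeVert s
    letI := fintypeVert t
    inferInstanceAs (Fintype (s.Vert ⊕ t.Vert))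

instance nonemptyVert : (t : Cotree) → Nonempty t.Vert
  | single => ⟨()⟩
  | union s _ => (nonemptyVert s).map Sum.inl
  | join s _ => (nonemptyVert s).map Sum.inl

lemma nontrivial_vert {t : Cotree} (ht : t ≠ single) : Nontrivial t.Vert := by
  cases t with
  | single => exact absurd rfl ht
  | union s t | join s t =>
    obtain ⟨u⟩ := s.nonemptyVert
    obtain ⟨v⟩ := t.nonemptyVert
    exact ⟨⟨.inl u, .inr v, Sum.inl_ne_inr⟩⟩

lemma outcome_graph (t : Cotree) : outcome t.graph = t.eval := by
  classical
  induction t with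
  | single => exact outcome_unit _
  | union s t ihs iht =>
    rw [eval, ← ihs, ← iht]
    exact outcome_union s.graph t.graph
  | join s t ihs iht =>
    by_cases hs : s = single
    · subst hs
      refine (outcome_universal_join (⊥ : SimpleGraph Unit) t.graph).trans ?_
      rw [iht, eval]
      split_ifs <;> simp_all [eval]
    by_cases ht : t = single
    · subst ht
      refine (outcome_iso (joinComm s.graph (⊥ : SimpleGraph Unit))).trans
        ((outcome_universal_join (⊥ : SimpleGraph Unit) s.graph).trans ?_)
      rw [ihs, eval]
      split_ifs <;> simp_all [eval]
    · have := nontrivial_vert hs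
      have := nontrivial_vert ht
      refine (outcome_join s.graph t.graph).trans ?_
      simp [eval, hs, ht]

end Cotree

/-- The outcome of a cograph is given by the recursion along any of its cotrees. -/
theorem outcome_eq_eval {V : Type*} (G : SimpleGraph V) (t : Cotree) (e : G ≃g t.graph) :
    outcome G = t.eval := by
  classical
  have := Fintype.ofEquiv _ e.toEquiv.symm
  rw [outcome_iso e, t.outcome_graph]

/-! ### Roots: the components with outcome `N` -/

section

variable {V W : Type*}

/-- `u` is a neighbor of `v` whose closed neighborhood is strictly smaller than that of `v`. -/
def Below (G : SimpleGraph V) (u v : V) : Prop :=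
  G.Adj u v ∧ (∀ w, InClosedNbhd G w u → InClosedNbhd G w v) ∧
    ∃ w, InClosedNbhd G w v ∧ ¬ InClosedNbhd G w u

/-- `u` is maximal among the vertices below `v`. -/
def CoveredBy (G : SimpleGraph V) (u v : V) : Prop :=
  Below G u v ∧ ∀ w, Below G u w → ¬ Below G w v

/-- One step of the recursion that marks the roots. A vertex `v` is to be marked if it is
comparable to all its neighbors, and it has nothing below it or covers two vertices of `X`. For a
universal vertex `v` of a connected cograph, with the right `X`, this says that `v` is the only
vertex or that removing `v` leaves a graph of outcome `S`. -/
def MarkStep (G : SimpleGraph V) (X : V → Prop) (v : V) : Prop :=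
  (∀ w, G.Adj w v → Below G w v ∨ Below G v w) ∧
    ((∀ u, ¬ Below G u v) ∨
      ∃ u₁ u₂, u₁ ≠ u₂ ∧ (CoveredBy G u₁ v ∧ X u₁) ∧ (CoveredBy G u₂ v ∧ X u₂))

/-- The vertices marked after `k` rounds. -/
def Marked (G : SimpleGraph V) (k : ℕ) : V → Prop := (MarkStep G)^[k] fun _ => False

/-- The marked vertices with nothing above them. -/
def IsRoot (G : SimpleGraph V) (k : ℕ) (v : V) : Prop :=
  Marked G k v ∧ ∀ w, ¬ Below G v w

/-- After `k` rounds there are two different roots. -/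
def HasTwoRoots (G : SimpleGraph V) (k : ℕ) : Prop :=
  ∃ v₁ v₂, v₁ ≠ v₂ ∧ IsRoot G k v₁ ∧ IsRoot G k v₂

/-- After `k` rounds there is a root. -/
def HasRoot (G : SimpleGraph V) (k : ℕ) : Prop := ∃ v, IsRoot G k v

open Classical in
/-- The outcome read off from the number of roots. -/
noncomputable def rootOutcome (G : SimpleGraph V) (k : ℕ) : Outcome :=
  if HasTwoRoots G k then .S else if HasRoot G k then .N else .D

variable {G : SimpleGraph V} {H : SimpleGraph W}

lemma marked_zero (v : V) : ¬ Marked G 0 v := by simp [Marked]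

lemma marked_succ (k : ℕ) (v : V) : Marked G (k + 1) v ↔ MarkStep G (Marked G k) v := by
  simp only [Marked, Function.iterate_succ_apply']

lemma not_below_self (v : V) : ¬ Below G v v := fun h => G.irrefl h.1

lemma inClosedNbhd_iso (e : G ≃g H) (u v : V) :
    InClosedNbhd H (e u) (e v) ↔ InClosedNbhd G u v := by
  simp [InClosedNbhd, e.map_adj_iff]

lemma below_iso (e : G ≃g H) (u v : V) : Below H (e u) (e v) ↔ Below G u v := by
  simp only [Below, e.map_adj_iff, e.surjective.forall, e.surjective.exists, inClosedNbhd_iso]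

lemma marked_iso (e : G ≃g H) (k : ℕ) (v : V) : Marked H k (e v) ↔ Marked G k v := by
  induction k generalizing v with
  | zero => simp [marked_zero]
  | succ k ih =>
    simp only [marked_succ, MarkStep, CoveredBy, e.surjective.forall, e.surjective.exists,
      e.map_adj_iff, below_iso, ih, e.injective.ne_iff]

lemma isRoot_iso (e : G ≃g H) (k : ℕ) (v : V) : IsRoot H k (e v) ↔ IsRoot G k v := by
  simp only [IsRoot, e.surjective.forall, below_iso, marked_iso]

lemma rootOutcome_iso (e : G ≃g H) (k : ℕ) : rootOutcome G k = rootOutcome H k := by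
  have h1 : HasTwoRoots H k ↔ HasTwoRoots G k := by
    simp only [HasTwoRoots, e.surjective.exists, isRoot_iso, e.injective.ne_iff]
  have h2 : HasRoot H k ↔ HasRoot G k := by
    simp only [HasRoot, e.surjective.exists, isRoot_iso]
  rw [rootOutcome, rootOutcome, h1, h2]

/-! ### Roots of unions -/

lemma below_union_inl {u v : V} : Below (G ⊕g H) (.inl u) (.inl v) ↔ Below G u v := by
  simp [Below]

lemma not_below_union_inl_inr {u : V} {v : W} : ¬ Below (G ⊕g H) (.inl u) (.inr v) := by
  simp [Below]

lemma not_below_union_inr_inl {u : W} {v : V} : ¬ Below (G ⊕g H) (.inr u) (.inl v) := by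
  simp [Below]

lemma marked_union_inl (k : ℕ) (v : V) : Marked (G ⊕g H) k (.inl v) ↔ Marked G k v := by
  induction k generalizing v with
  | zero => simp [marked_zero]
  | succ k ih =>
    simp [marked_succ, MarkStep, CoveredBy, below_union_inl, not_below_union_inl_inr,
      not_below_union_inr_inl, ih]

lemma isRoot_union_inl (k : ℕ) (v : V) : IsRoot (G ⊕g H) k (.inl v) ↔ IsRoot G k v := by
  simp [IsRoot, marked_union_inl, below_union_inl, not_below_union_inl_inr]

lemma isRoot_union_inr (k : ℕ) (v : W) : IsRoot (G ⊕g H) k (.inr v) ↔ IsRoot H k v := by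
  exact (isRoot_iso (unionComm H G) k (.inl v)).trans (isRoot_union_inl k v)

lemma rootOutcome_union (k : ℕ) :
    rootOutcome (G ⊕g H) k = unionRule (rootOutcome G k) (rootOutcome H k) := by
  have h1 : HasRoot (G ⊕g H) k ↔ HasRoot G k ∨ HasRoot H k := by
    simp [HasRoot, isRoot_union_inl, isRoot_union_inr]
  have h2 : HasTwoRoots (G ⊕g H) k ↔
      HasTwoRoots G k ∨ HasTwoRoots H k ∨ (HasRoot G k ∧ HasRoot H k) := by
    simp only [HasTwoRoots, HasRoot, Sum.exists, isRoot_union_inl, isRoot_union_inr, ne_eq,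
      Sum.inl.injEq, Sum.inr.injEq, reduceCtorEq, not_false_eq_true, true_and]
    constructor
    · rintro (⟨v, ⟨w, h⟩ | ⟨w, h, h'⟩⟩ | ⟨v, ⟨w, h, h'⟩ | ⟨w, h⟩⟩)
      · exact .inl ⟨v, w, h⟩
      · exact .inr (.inr ⟨⟨v, h⟩, ⟨w, h'⟩⟩)
      · exact .inr (.inr ⟨⟨w, h'⟩, ⟨v, h⟩⟩)
      · exact .inr (.inl ⟨v, w, h⟩)
    · rintro (⟨v, w, h⟩ | ⟨v, w, h⟩ | ⟨⟨v, h⟩, ⟨w, h'⟩⟩)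
      · exact .inl ⟨v, .inl ⟨w, h⟩⟩
      · exact .inr ⟨v, .inr ⟨w, h⟩⟩
      · exact .inl ⟨v, .inr ⟨w, h, h'⟩⟩
  have hG : HasTwoRoots G k → HasRoot G k := fun ⟨v, _, _, h, _⟩ => ⟨v, h⟩
  have hH : HasTwoRoots H k → HasRoot H k := fun ⟨v, _, _, h, _⟩ => ⟨v, h⟩
  unfold rootOutcome
  rw [h1, h2]
  split_ifs <;> first | rfl | (exfalso; tauto)

/-! ### Roots of joins -/

lemma IsRoot.below_of_adj {k : ℕ} {v w : V} (h : IsRoot G k v) (hw : G.Adj w v) :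
    Below G w v := by
  cases k with
  | zero => exact absurd h.1 (marked_zero v)
  | succ k => exact (((marked_succ k v).1 h.1).1 w hw).resolve_right (h.2 w)

/-- A vertex of a join that lies above some vertex of the other side is universal. -/
lemma universal_of_below_join_inl {v : V} {w : W} (h : Below (joinGraph G H) (.inr w) (.inl v))
    (z : V ⊕ W) : InClosedNbhd (joinGraph G H) z (.inl v) := by
  rcases z with z | z
  · exact h.2.1 _ (by simp)
  · simp

lemma universal_of_below_join_inr {v : V} {w : W} (h : Below (joinGraph G H) (.inl v) (.inr w))
    (z : V ⊕ W) : InClosedNbhd (joinGraph G H) z (.inr w) := by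
  rcases z with z | z
  · simp
  · exact h.2.1 _ (by simp)

lemma IsRoot.universal_join [Nonempty V] [Nonempty W] {k : ℕ} {z : V ⊕ W}
    (h : IsRoot (joinGraph G H) k z) (y : V ⊕ W) : InClosedNbhd (joinGraph G H) y z := by
  rcases z with v | w
  · exact universal_of_below_join_inl
      (h.below_of_adj (w := .inr (Classical.arbitrary W)) (by simp)) y
  · exact universal_of_below_join_inr
      (h.below_of_adj (w := .inl (Classical.arbitrary V)) (by simp)) y

/-- A root of a join is universal. If each side has a vertex other than the root, then a marked
vertex covered by the root would be universal too, although it is strictly below the root. -/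
lemma not_isRoot_join [Nontrivial V] [Nontrivial W] (k : ℕ) (z : V ⊕ W) :
    ¬ IsRoot (joinGraph G H) k z := by
  intro h
  have huniv := h.universal_join
  cases k with
  | zero => exact marked_zero z h.1
  | succ k =>
    rcases ((marked_succ k z).1 h.1).2 with hnone | ⟨u, _, _, ⟨hu, hum⟩, _⟩
    · rcases z with v | w
      · exact hnone _ (h.below_of_adj (w := .inr (Classical.arbitrary W)) (by simp))
      · exact hnone _ (h.below_of_adj (w := .inl (Classical.arbitrary V)) (by simp))
    · obtain ⟨y, -, hy⟩ := hu.1.2.2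
      have hbelow : ∀ w, (joinGraph G H).Adj w u → w ≠ z → Below (joinGraph G H) w u := by
        intro w hw hwz
        cases k with
        | zero => exact absurd hum (marked_zero u)
        | succ k =>
          refine (((marked_succ k u).1 hum).1 w hw).resolve_right fun hb => hu.2 w hb ?_
          exact h.below_of_adj (((huniv w).resolve_left hwz).symm)
      apply hy
      rcases u with u | u
      · obtain ⟨w, hw⟩ : ∃ w : W, (.inr w : V ⊕ W) ≠ z := by
          rcases z with v | w
          · exact ⟨Classical.arbitrary W, by simp⟩
          · obtain ⟨w', hw'⟩ := exists_ne w
            exact ⟨w', by simpa using hw'⟩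
        exact universal_of_below_join_inl (hbelow (.inr w) (by simp) hw) y
      · obtain ⟨w, hw⟩ : ∃ w : V, (.inl w : V ⊕ W) ≠ z := by
          rcases z with v | w
          · obtain ⟨w', hw'⟩ := exists_ne v
            exact ⟨w', by simpa using hw'⟩
          · exact ⟨Classical.arbitrary V, by simp⟩
        exact universal_of_below_join_inr (hbelow (.inl w) (by simp) hw) y

section

variable {K : SimpleGraph Unit}

lemma below_join_inr {u v : W} : Below (joinGraph K H) (.inr u) (.inr v) ↔ Below H u v := by
  simp [Below]

lemma below_join_universal {u : W} {a : Unit} : Below (joinGraph K H) (.inr u) (.inl a) ↔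
    ∃ w, ¬ InClosedNbhd H w u := by
  simp [Below, InClosedNbhd]

lemma not_below_join_universal {u : W} {a : Unit} : ¬ Below (joinGraph K H) (.inl a) (.inr u) := by
  simp [Below, InClosedNbhd]

lemma marked_universal_join (hH : ∀ u : W, ∃ w, ¬ InClosedNbhd H w u) (k : ℕ) (v : W) :
    Marked (joinGraph K H) k (.inr v) ↔ Marked H k v := by
  induction k generalizing v with
  | zero => simp [marked_zero]
  | succ k ih =>
    simp [marked_succ, MarkStep, CoveredBy, below_join_inr, below_join_universal,
      not_below_join_universal, ih, hH]

lemma marked_universal [Nonempty W] (hH : ∀ u : W, ∃ w, ¬ InClosedNbhd H w u) (k : ℕ) :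
    Marked (joinGraph K H) (k + 1) (.inl ()) ↔ HasTwoRoots H k := by
  simp [marked_succ, MarkStep, CoveredBy, below_join_inr, below_join_universal, HasTwoRoots,
      not_below_join_universal, marked_universal_join, hH, not_below_self, IsRoot, and_comm]

/-- A universal vertex would be below any root different from it. -/
lemma HasTwoRoots.not_universal {k : ℕ} (h : HasTwoRoots H k) (u : W) :
    ∃ w, ¬ InClosedNbhd H w u := by
  by_contra! hu
  obtain ⟨r, hr, hroot⟩ : ∃ r, u ≠ r ∧ IsRoot H k r := by
    obtain ⟨r₁, r₂, hne, h₁, h₂⟩ := h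
    by_cases hr : u = r₁
    · exact ⟨r₂, fun h => hne (hr.symm.trans h), h₂⟩
    · exact ⟨r₁, hr, h₁⟩
  obtain ⟨-, -, w, -, hw⟩ := hroot.below_of_adj (((hu r).resolve_left hr.symm))
  exact hw (hu w)

open Classical in
lemma rootOutcome_universal_join [Nonempty W] (k : ℕ) :
    rootOutcome (joinGraph K H) (k + 1) = if HasTwoRoots H k then .N else .D := by
  -- the only possible root is the universal vertex
  have hroot : ∀ z, IsRoot (joinGraph K H) (k + 1) z ↔ z = .inl () ∧ HasTwoRoots H k := by
    intro z
    constructor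
    · intro h
      rcases z with z | w
      · have hH : ∀ u : W, ∃ w, ¬ InClosedNbhd H w u := fun u =>
          below_join_universal.1 (h.below_of_adj (w := .inr u) (by simp))
        exact ⟨rfl, (marked_universal hH k).1 h.1⟩
      · exact absurd (h.below_of_adj (w := .inl ()) (by simp)) not_below_join_universal
    · rintro ⟨rfl, h⟩
      refine ⟨(marked_universal h.not_universal k).2 h, ?_⟩
      rintro (w | w)
      · exact not_below_self _
      · exact not_below_join_universal
  have h1 : ¬ HasTwoRoots (joinGraph K H) (k + 1) := by
    rintro ⟨v, w, hne, hv, hw⟩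
    exact hne (((hroot v).1 hv).1.trans ((hroot w).1 hw).1.symm)
  have h2 : HasRoot (joinGraph K H) (k + 1) ↔ HasTwoRoots H k := by
    simp [HasRoot, hroot]
  rw [rootOutcome, if_neg h1, h2]

end

lemma rootOutcome_eq_S {k : ℕ} : rootOutcome G k = .S ↔ HasTwoRoots G k := by
  unfold rootOutcome
  split_ifs <;> simp_all

lemma rootOutcome_join [Nontrivial V] [Nontrivial W] (k : ℕ) :
    rootOutcome (joinGraph G H) k = .D := by
  simp [rootOutcome, HasTwoRoots, HasRoot, not_isRoot_join]

lemma rootOutcome_unit (K : SimpleGraph Unit) (k : ℕ) : rootOutcome K (k + 1) = .N := by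
  have hb : ∀ u v, ¬ Below K u v := fun u v => not_below_self v
  have h1 : ¬ HasTwoRoots K (k + 1) := by simp [HasTwoRoots]
  have h2 : HasRoot K (k + 1) := ⟨(), by simp [marked_succ, MarkStep, hb], hb ()⟩
  simp [rootOutcome, h1, h2]

end

/-- Counting the roots gives the value of a cotree, after as many rounds as there are vertices. -/
lemma Cotree.rootOutcome_graph (t : Cotree) (k : ℕ) (hk : Fintype.card t.Vert ≤ k) :
    rootOutcome t.graph k = t.eval := by
  classical
  induction t generalizing k with
  | single =>
    obtain ⟨k, rfl⟩ : ∃ l, k = l + 1 :=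
      Nat.exists_eq_succ_of_ne_zero (Nat.pos_iff_ne_zero.1 (Fintype.card_pos.trans_le hk))
    exact rootOutcome_unit _ _
  | union s t ihs iht =>
    have hk : Fintype.card s.Vert + Fintype.card t.Vert ≤ k := by
      rw [← Fintype.card_sum]; exact hk
    rw [eval, ← ihs k (by omega), ← iht k (by omega)]
    exact rootOutcome_union (G := s.graph) (H := t.graph) k
  | join s t ihs iht =>
    have hk : Fintype.card s.Vert + Fintype.card t.Vert ≤ k := by
      rw [← Fintype.card_sum]; exact hk
    have hs0 := Fintype.card_pos (α := s.Vert)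
    have ht0 := Fintype.card_pos (α := t.Vert)
    obtain ⟨k, rfl⟩ : ∃ l, k = l + 1 := Nat.exists_eq_succ_of_ne_zero (by omega)
    by_cases hs : s = single
    · subst hs
      refine (rootOutcome_universal_join (K := (⊥ : SimpleGraph Unit)) (H := t.graph) k).trans ?_
      rw [← rootOutcome_eq_S, iht k (by omega), eval]
      split_ifs <;> simp_all [eval]
    by_cases ht : t = single
    · subst ht
      refine (rootOutcome_iso (joinComm s.graph (⊥ : SimpleGraph Unit)) _).trans
        ((rootOutcome_universal_join (K := (⊥ : SimpleGraph Unit)) (H := s.graph) k).trans ?_)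
      rw [← rootOutcome_eq_S, ihs k (by omega), eval]
      split_ifs <;> simp_all [eval]
    · have := nontrivial_vert hs
      have := nontrivial_vert ht
      refine (rootOutcome_join (G := s.graph) (H := t.graph) _).trans ?_
      simp [eval, hs, ht]

/-- The outcome of a cograph is determined by the number of its roots. -/
theorem outcome_eq_rootOutcome {n : ℕ} (G : SimpleGraph (Fin n)) (hG : IsCograph G) :
    outcome G = rootOutcome G n := by
  obtain ⟨t, ⟨e⟩⟩ := hG
  rw [outcome_eq_eval G t e, rootOutcome_iso e, t.rootOutcome_graph]
  rw [← Fintype.card_congr e.toEquiv, Fintype.card_fin]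

end MBDomination

/-! ### Programs that sweep over a word -/

namespace SweepProgram

open Turing

/-- Programs that act on a register of type `σ` and a word over `Γ`. The only access to the word
is a sweep, which rewrites it letter by letter from left to right with a finite transducer. -/
inductive Prog (σ Γ : Type) where
  | sweep (δ : σ → Γ → σ × Γ)
  | load (f : σ → σ)
  | seq (p q : Prog σ Γ)
  | ite (b : σ → Bool) (p q : Prog σ Γ)
  | while (b : σ → Bool) (p : Prog σ Γ)

section Semantics

variable {σ Γ : Type}

/-- The result of running the transducer `δ` over a word. -/
def transduce (δ : σ → Γ → σ × Γ) : σ → List Γ → σ × List Γ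
  | v, [] => (v, [])
  | v, a :: w => ((transduce δ (δ v a).1 w).1, (δ v a).2 :: (transduce δ (δ v a).1 w).2)

/-- `Exec p s t s'`: from register and word `s`, the program `p` terminates in `s'`. The number `t`
is the number of steps that the machine compiled from `p` takes. -/
inductive Exec : Prog σ Γ → σ × List Γ → ℕ → σ × List Γ → Prop
  | sweep (δ v w) : Exec (.sweep δ) (v, w) (2 * w.length + 2) (transduce δ v w)
  | load (f v w) : Exec (.load f) (v, w) 1 (f v, w)
  | seq {p q s t s' t' s''} (hp : Exec p s t s') (hq : Exec q s' t' s'') :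
      Exec (.seq p q) s (t + t') s''
  | ite_true {b p q s t s'} (hb : b s.1 = true) (hp : Exec p s t s') :
      Exec (.ite b p q) s (1 + t) s'
  | ite_false {b p q s t s'} (hb : b s.1 = false) (hq : Exec q s t s') :
      Exec (.ite b p q) s (1 + t) s'
  | while_false {b p s} (hb : b s.1 = false) : Exec (.while b p) s 1 s
  | while_true {b p s t s' t' s''} (hb : b s.1 = true) (hp : Exec p s t s')
      (hw : Exec (.while b p) s' t' s'') : Exec (.while b p) s (1 + (t + t')) s''

lemma length_transduce (δ : σ → Γ → σ × Γ) (v : σ) (w : List Γ) :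
    (transduce δ v w).2.length = w.length := by
  induction w generalizing v with
  | nil => rfl
  | cons a w ih => simp [transduce, ih]

lemma transduce_append (δ : σ → Γ → σ × Γ) (v : σ) (w₁ w₂ : List Γ) :
    transduce δ v (w₁ ++ w₂) = ((transduce δ (transduce δ v w₁).1 w₂).1,
      (transduce δ v w₁).2 ++ (transduce δ (transduce δ v w₁).1 w₂).2) := by
  induction w₁ generalizing v with
  | nil => rfl
  | cons a w ih => simp [transduce, ih]

lemma Exec.length_eq {p : Prog σ Γ} {s s' : σ × List Γ} {t : ℕ} (h : Exec p s t s') :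
    s'.2.length = s.2.length := by
  induction h with
  | sweep => exact length_transduce _ _ _
  | load | while_false => rfl
  | seq _ _ h₁ h₂ | while_true _ _ _ h₁ h₂ => exact h₂.trans h₁
  | ite_true _ _ h | ite_false _ _ h => exact h

end Semantics

/-! ### Compilation to stack machines -/

/-- The stacks of the compiled machine. Between sweeps the word lies on `left`; a sweep moves it
to `right` and back. -/
inductive Stk
  | inp | left | right | out
  deriving DecidableEq

instance : Fintype Stk := ⟨{.inp, .left, .right, .out}, by rintro (_ | _ | _ | _) <;> decide⟩

/-- The alphabets of the stacks. -/
def Alph (A Γ B : Type) : Stk → Type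
  | .inp => A
  | .left => Γ
  | .right => Γ
  | .out => B

/-- The labels needed for a program. -/
def Lab {σ Γ : Type} : Prog σ Γ → Type
  | .sweep _ => Bool
  | .load _ => Unit
  | .seq p q => Lab p ⊕ Lab q
  | .ite _ p q => Option (Lab p ⊕ Lab q)
  | .while _ p => Option (Lab p)

instance Lab.fintype {σ Γ : Type} : (p : Prog σ Γ) → Fintype (Lab p)
  | .sweep _ => inferInstanceAs (Fintype Bool)
  | .load _ => inferInstanceAs (Fintype Unit)
  | .seq p q =>
    letI := Lab.fintype p
    letI := Lab.fintype q
    inferInstanceAs (Fintype (Lab p ⊕ Lab q))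
  | .ite _ p q =>
    letI := Lab.fintype p
    letI := Lab.fintype q
    inferInstanceAs (Fintype (Option (Lab p ⊕ Lab q)))
  | .while _ p =>
    letI := Lab.fintype p
    inferInstanceAs (Fintype (Option (Lab p)))

/-- The label at which a program starts. -/
def entry {σ Γ : Type} : (p : Prog σ Γ) → Lab p
  | .sweep _ => true
  | .load _ => ()
  | .seq p _ => .inl (entry p)
  | .ite _ _ _ => none
  | .while _ _ => none

section Compile

variable {A Γ B σ : Type} [Inhabited Γ]

/-- Pops letters from stack `k` one at a time, applying `f` to the state; as long as `f` leaves a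
letter in the buffer, that letter is pushed on stack `k'` and control stays at `self`. -/
def moveStmt {Λ : Type} (k k' : Stk)
    (f : σ × Option Γ → Option (Alph A Γ B k) → σ × Option Γ) (g : Γ → Alph A Γ B k')
    (self next : Λ) : TM2.Stmt (Alph A Γ B) Λ (σ × Option Γ) :=
  .pop k f (.branch (fun v => v.2.isSome)
    (.push k' (fun v => g (v.2.getD default)) (.goto fun _ => self))
    (.goto fun _ => next))

/-- The statements of the machine compiled from a program whose labels are embedded by `emb` and
which continues at `exit`. The second component of the state is a buffer for one letter. -/
def code {Λ : Type} : (p : Prog σ Γ) → (Lab p → Λ) → Λ → Lab p →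
    TM2.Stmt (Alph A Γ B) Λ (σ × Option Γ)
  | .sweep δ, emb, exit, l => Bool.rec
      (moveStmt .right .left (fun v o => (v.1, o)) id (emb false) exit)
      (moveStmt .left .right (fun v o => ((o.elim v.1 fun a => (δ v.1 a).1),
        Option.map (fun a => (δ v.1 a).2) o)) id (emb true) (emb false)) l
  | .load f, _, exit, _ => .load (fun v => (f v.1, none)) (.goto fun _ => exit)
  | .seq p q, emb, exit, l => Sum.rec
      (code p (fun l => emb (.inl l)) (emb (.inr (entry q))))
      (code q (fun l => emb (.inr l)) exit) l
  | .ite b p q, emb, exit, l => Option.rec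
      (.branch (fun v => b v.1) (.goto fun _ => emb (some (.inl (entry p))))
        (.goto fun _ => emb (some (.inr (entry q)))))
      (fun l => Sum.rec (code p (fun l => emb (some (.inl l))) exit)
        (code q (fun l => emb (some (.inr l))) exit) l) l
  | .while b p, emb, exit, l => Option.rec
      (.branch (fun v => b v.1) (.goto fun _ => emb (some (entry p))) (.goto fun _ => exit))
      (code p (fun l => emb (some l)) (emb none)) l

/-- The stack contents, given by the four words. -/
def stackWords (i : List A) (l r : List Γ) (o : List B) : ∀ k, List (Alph A Γ B k)
  | .inp => i
  | .left => l
  | .right => r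
  | .out => o

/-- `Steps M t c c'`: the machine gets from `c` to `c'` in exactly `t` steps. -/
def Steps {K : Type} [DecidableEq K] {Γ : K → Type} {Λ σ : Type} (M : Λ → TM2.Stmt Γ Λ σ) (t : ℕ)
    (c c' : TM2.Cfg Γ Λ σ) : Prop :=
  (flip bind (TM2.step M))^[t] (some c) = some c'

section Steps

variable {K : Type} [DecidableEq K] {Γ : K → Type} {Λ σ : Type} {M : Λ → TM2.Stmt Γ Λ σ}

lemma Steps.trans {t t' : ℕ} {c c' c'' : TM2.Cfg Γ Λ σ} (h : Steps M t c c')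
    (h' : Steps M t' c' c'') : Steps M (t + t') c c'' := by
  unfold Steps at *
  rw [add_comm, Function.iterate_add_apply, h, h']

lemma Steps.of_step {l : Λ} {v : σ} {S : ∀ k, List (Γ k)} {c' : TM2.Cfg Γ Λ σ}
    (h : TM2.stepAux (M l) v S = c') : Steps M 1 ⟨some l, v, S⟩ c' := by
  subst h; rfl

end Steps

variable {Λ : Type} {M : Λ → TM2.Stmt (Alph A Γ B) Λ (σ × Option Γ)}

lemma steps_back {self next : Λ}
    (hM : M self = moveStmt .right .left (fun v o => (v.1, o)) id self next)
    (l r : List Γ) (v : σ) (b : Option Γ) :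
    Steps M (r.length + 1) ⟨some self, (v, b), stackWords [] l r []⟩
      ⟨some next, (v, none), stackWords [] (r.reverse ++ l) [] []⟩ := by
  induction r generalizing l b with
  | nil =>
    refine Steps.of_step ?_
    rw [hM]
    change TM2.Cfg.mk _ _ _ = TM2.Cfg.mk _ _ _
    congr 1
    funext k; cases k <;> rfl
  | cons a r ih =>
    rw [List.length_cons, add_comm]
    refine (Steps.of_step (c' := ⟨some self, (v, some a), stackWords [] (a :: l) r []⟩) ?_).trans ?_
    · rw [hM]
      change TM2.Cfg.mk _ _ _ = TM2.Cfg.mk _ _ _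
      congr 1
      funext k; cases k <;> rfl
    · simpa using ih (a :: l) (some a)

lemma steps_forward {self next : Λ} {δ : σ → Γ → σ × Γ}
    (hM : M self = moveStmt .left .right (fun v o => ((o.elim v.1 fun a => (δ v.1 a).1),
        Option.map (fun a => (δ v.1 a).2) o)) id self next)
    (l r : List Γ) (v : σ) (b : Option Γ) :
    Steps M (l.length + 1) ⟨some self, (v, b), stackWords [] l r []⟩
      ⟨some next, ((transduce δ v l).1, none),
        stackWords [] [] ((transduce δ v l).2.reverse ++ r) []⟩ := by
  induction l generalizing r v b with
  | nil =>
    refine Steps.of_step ?_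
    rw [hM]
    change TM2.Cfg.mk _ _ _ = TM2.Cfg.mk _ _ _
    congr 1
    funext k; cases k <;> rfl
  | cons a l ih =>
    rw [List.length_cons, add_comm]
    refine (Steps.of_step (c' := ⟨some self, ((δ v a).1, some (δ v a).2),
      stackWords [] l ((δ v a).2 :: r) []⟩) ?_).trans ?_
    · rw [hM]
      change TM2.Cfg.mk _ _ _ = TM2.Cfg.mk _ _ _
      congr 1
      funext k; cases k <;> rfl
    · simpa [transduce] using ih ((δ v a).2 :: r) (δ v a).1 (some (δ v a).2)

/-- The compiled machine follows the semantics of the program. -/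
lemma steps_of_exec {p : Prog σ Γ} {s s' : σ × List Γ} {t : ℕ} (h : Exec p s t s')
    (emb : Lab p → Λ) (exit : Λ) (hM : ∀ l, M (emb l) = code p emb exit l) :
    Steps M t ⟨some (emb (entry p)), (s.1, none), stackWords [] s.2 [] []⟩
      ⟨some exit, (s'.1, none), stackWords [] s'.2 [] []⟩ := by
  induction h generalizing exit with
  | sweep δ v w =>
    have h1 := steps_forward (hM true) w [] v none
    have h2 := steps_back (hM false) [] ((transduce δ v w).2.reverse ++ []) (transduce δ v w).1 none
    have h := h1.trans h2
    simp only [List.append_nil, List.length_reverse, length_transduce, List.reverse_reverse] at h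
    rw [show 2 * w.length + 2 = w.length + 1 + (w.length + 1) by ring]
    exact h
  | load f v w => exact Steps.of_step (by rw [hM]; rfl)
  | seq _ _ ih₁ ih₂ =>
    exact (ih₁ (fun l => emb (.inl l)) _ fun l => hM (.inl l)).trans
      (ih₂ (fun l => emb (.inr l)) exit fun l => hM (.inr l))
  | ite_true hb _ ih =>
    refine Steps.trans (Steps.of_step ?_)
      (ih (fun l => emb (some (.inl l))) exit fun l => hM (some (.inl l)))
    rw [hM]
    simp [code, entry, hb]
  | ite_false hb _ ih =>
    refine Steps.trans (Steps.of_step ?_)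
      (ih (fun l => emb (some (.inr l))) exit fun l => hM (some (.inr l)))
    rw [hM]
    simp [code, entry, hb]
  | while_false hb =>
    refine Steps.of_step ?_
    rw [hM]
    simp [code, entry, hb]
  | while_true hb _ _ ih₁ ih₂ =>
    refine Steps.trans (Steps.of_step ?_)
      ((ih₁ (fun l => emb (some l)) (emb none) fun l => hM (some l)).trans (ih₂ emb exit hM))
    rw [hM]
    simp [code, entry, hb]

end Compile

/-- The labels outside the program: reading the input, moving it back to the stack `left`, and
erasing the word at the end. -/
inductive Phase
  | read | back | erase
  deriving DecidableEq

instance : Fintype Phase := ⟨{.read, .back, .erase}, by rintro (_ | _ | _) <;> decide⟩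

section Machine

variable {A Γ B σ : Type} [Inhabited Γ] [Fintype A] [Fintype Γ] [Fintype σ]

/-- The machine that turns the input into a word by `cell`, letter by letter, runs the program `p`
on it from the register `v₀`, and outputs one letter read off from the register by `res`. -/
def machine (cell : A → Γ) (v₀ : σ) (p : Prog σ Γ) (res : σ → B) : FinTM2 where
  K := Stk
  k₀ := .inp
  k₁ := .out
  Γ := Alph A Γ B
  Λ := Lab p ⊕ Phase
  main := .inr .read
  σ := σ × Option Γ
  initialState := (v₀, none)
  Γk₀Fin := inferInstanceAs (Fintype A)
  m := Sum.elim (code p Sum.inl (.inr .erase)) fun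
    | .read => moveStmt .inp .right (fun v o => (v.1, Option.map cell o)) id
        (.inr .read) (.inr .back)
    | .back => moveStmt .right .left (fun v o => (v.1, o)) id (.inr .back) (.inl (entry p))
    | .erase => .pop .left (fun v o => (v.1, o)) (.branch (fun v => v.2.isSome)
        (.goto fun _ => .inr .erase)
        (.push .out (fun v => res v.1) (.load (fun _ => (v₀, none)) .halt)))

variable {cell : A → Γ} {v₀ : σ} {p : Prog σ Γ} {res : σ → B}

lemma steps_read (i : List A) (r : List Γ) (b : Option Γ) :
    Steps (machine cell v₀ p res).m (i.length + 1)
      ⟨some (.inr .read), (v₀, b), stackWords i [] r []⟩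
      ⟨some (.inr .back), (v₀, none), stackWords [] [] ((i.map cell).reverse ++ r) []⟩ := by
  induction i generalizing r b with
  | nil =>
    refine Steps.of_step ?_
    change TM2.Cfg.mk _ _ _ = TM2.Cfg.mk _ _ _
    congr 1
    funext k; cases k <;> rfl
  | cons a i ih =>
    rw [List.length_cons, add_comm]
    refine (Steps.of_step (c' := ⟨some (.inr .read), (v₀, some (cell a)),
      stackWords i [] (cell a :: r) []⟩) ?_).trans ?_
    · change TM2.Cfg.mk _ _ _ = TM2.Cfg.mk _ _ _
      congr 1
      funext k; cases k <;> rfl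
    · have := ih (cell a :: r) (some (cell a))
      rw [List.map_cons, List.reverse_cons, List.append_assoc]
      exact this

lemma steps_erase (l : List Γ) (v : σ) (b : Option Γ) :
    Steps (machine cell v₀ p res).m (l.length + 1)
      ⟨some (.inr .erase), (v, b), stackWords [] l [] []⟩
      ⟨none, (v₀, none), stackWords [] [] [] [res v]⟩ := by
  induction l generalizing b with
  | nil =>
    refine Steps.of_step ?_
    change TM2.Cfg.mk _ _ _ = TM2.Cfg.mk _ _ _
    congr 1
    funext k; cases k <;> rfl
  | cons a l ih =>
    rw [List.length_cons, add_comm]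
    refine (Steps.of_step (c' := ⟨some (.inr .erase), (v, some a),
      stackWords [] l [] []⟩) ?_).trans (ih _)
    change TM2.Cfg.mk _ _ _ = TM2.Cfg.mk _ _ _
    congr 1
    funext k; cases k <;> rfl

lemma machine_steps {x : List A} {t : ℕ} {s : σ × List Γ} (h : Exec p (v₀, x.map cell) t s) :
    Steps (machine cell v₀ p res).m (3 * x.length + 3 + t)
      (initList (machine cell v₀ p res) x) (haltList (machine cell v₀ p res) [res s.1]) := by
  have h1 := steps_read (v₀ := v₀) (cell := cell) (p := p) (res := res) x [] none
  have h2 := steps_back (M := (machine cell v₀ p res).m) (self := .inr .back) rfl []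
    ((x.map cell).reverse ++ []) v₀ none
  have h3 := steps_of_exec (M := (machine cell v₀ p res).m) h Sum.inl (.inr .erase) fun _ => rfl
  have h4 := steps_erase (v₀ := v₀) (cell := cell) (p := p) (res := res) s.2 s.1 none
  rw [h.length_eq] at h4
  simp only [List.append_nil, List.reverse_reverse, List.length_reverse, List.length_map]
    at h1 h2 h3 h4
  have := ((h1.trans h2).trans h3).trans h4
  rw [show 3 * x.length + 3 + t = x.length + 1 + (x.length + 1) + t + (x.length + 1) by ring]
  have hi : initList (machine cell v₀ p res) x =
      ⟨some (.inr .read), (v₀, none), stackWords x [] [] []⟩ := by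
    change TM2.Cfg.mk _ _ _ = TM2.Cfg.mk _ _ _
    congr 1
    funext k; cases k <;> rfl
  have ho : haltList (machine cell v₀ p res) [res s.1] =
      ⟨none, (v₀, none), stackWords [] [] [] [res s.1]⟩ := by
    change TM2.Cfg.mk _ _ _ = TM2.Cfg.mk _ _ _
    congr 1
    funext k; cases k <;> rfl
  rw [hi, ho]
  exact this

/-- A function that is computed by a sweeping program within a polynomial number of steps is
computable in polynomial time. -/
lemma computableInPolyTime {α : Type} {enc : α → List A} {f : α → B} (time : Polynomial ℕ)
    (h : ∀ a, ∃ t s, Exec p (v₀, (enc a).map cell) t s ∧ res s.1 = f a ∧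
      t ≤ time.eval (enc a).length) :
    Nonempty (TM2ComputableInPolyTime enc (fun b : B => [b]) f) := by
  refine ⟨{
    tm := machine cell v₀ p res
    inputAlphabet := Equiv.refl A
    outputAlphabet := Equiv.refl B
    time := 3 * Polynomial.X + 3 + time
    outputsFun := fun a => ⟨⟨3 * (enc a).length + 3 + (h a).choose, ?_⟩, ?_⟩ }⟩
  · obtain ⟨s, h1, h2, h3⟩ := (h a).choose_spec
    have := machine_steps (res := res) h1
    rw [h2] at this
    refine Eq.trans ?_ this
    exact congrArg (fun l => (flip bind (machine cell v₀ p res).step)^[_]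
      (some (initList (machine cell v₀ p res) l))) (List.map_id (enc a))
  · obtain ⟨s, h1, h2, h3⟩ := (h a).choose_spec
    simpa using h3

end Machine

end SweepProgram

/-! ### Adjacency matrices with marks -/

namespace SweepProgram

/-- The letters of the working word: the entries of the adjacency matrix and the ends of its rows,
with marks. The variables in `ι` range over vertices; an entry is marked with the variables whose
value is its row and with those whose value is its column. The bits `cur` and `next` store two sets
of vertices, at every letter of the row of the vertex. -/
structure Cell (ι : Type) where
  kind : Option Bool
  row : ι → Bool
  col : ι → Bool
  cur : Bool
  next : Bool

/-- The register: the result of the last test, and two bits that move the marks. -/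
structure Reg where
  res : Bool
  row : Bool
  col : Bool

instance (ι : Type) : Inhabited (Cell ι) := ⟨⟨none, fun _ => false, fun _ => false, false, false⟩⟩

noncomputable instance (ι : Type) [Fintype ι] : Fintype (Cell ι) := by
  classical
  exact Fintype.ofInjective
    (fun c : Cell ι => (c.kind, c.row, c.col, c.cur, c.next))
    (by rintro ⟨⟩ ⟨⟩ h; simpa using h)

noncomputable instance : Fintype Reg :=
  Fintype.ofInjective (fun v : Reg => (v.res, v.row, v.col)) (by rintro ⟨⟩ ⟨⟩ h; simpa using h)

section Words

variable {ι : Type} {n : ℕ}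

open Classical in
/-- The entry of the word in row `i` and column `j`. The value `x a` of a variable is a vertex or,
where the variable is unset, at least `n`. -/
noncomputable def entryCell (G : SimpleGraph (Fin n)) (x : ι → ℕ) (X Y : Fin n → Prop)
    (i j : Fin n) : Cell ι where
  kind := some (decide (G.Adj i j))
  row a := decide (x a = i)
  col a := decide (x a = j)
  cur := decide (X i)
  next := decide (Y i)

open Classical in
/-- The letter at the end of row `i`. -/
noncomputable def endCell (x : ι → ℕ) (X Y : Fin n → Prop) (i : Fin n) : Cell ι where
  kind := none
  row a := decide (x a = i)
  col _ := false
  cur := decide (X i)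
  next := decide (Y i)

/-- The working word for a graph, a valuation of the variables and two sets of vertices. -/
noncomputable def word (G : SimpleGraph (Fin n)) (x : ι → ℕ) (X Y : Fin n → Prop) :
    List (Cell ι) :=
  (List.finRange n).flatMap fun i =>
    ((List.finRange n).flatMap fun j => [entryCell G x X Y i j]) ++ [endCell x X Y i]

/-- The letter of the working word without marks. -/
def blankCell (k : Option Bool) : Cell ι := ⟨k, fun _ => false, fun _ => false, false, false⟩

lemma map_blankCell_encodeGraph (G : SimpleGraph (Fin n)) :
    (MBDomination.encodeGraph G).map blankCell =
      word (ι := ι) G (fun _ => n) (fun _ => False) fun _ => False := by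
  have h : ∀ i : Fin n, n ≠ i := fun i => i.isLt.ne'
  simp [MBDomination.encodeGraph, word, List.map_flatMap, blankCell, entryCell, endCell, h,
    Function.comp_def, ← List.map_eq_flatMap]

lemma length_word (G : SimpleGraph (Fin n)) (x : ι → ℕ) (X Y : Fin n → Prop) :
    (word G x X Y).length = n * (n + 1) := by
  simp [word, ← List.map_eq_flatMap]

lemma any_word (G : SimpleGraph (Fin n)) (x : ι → ℕ) (X Y : Fin n → Prop) (P : Cell ι → Bool) :
    (word G x X Y).any P = true ↔
      ∃ i, (∃ j, P (entryCell G x X Y i j) = true) ∨ P (endCell x X Y i) = true := by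
  simp [word, List.any_flatMap, ← List.map_eq_flatMap]

lemma map_word (G : SimpleGraph (Fin n)) (x x' : ι → ℕ) (X Y X' Y' : Fin n → Prop)
    (g : Cell ι → Cell ι) (h₁ : ∀ i j, g (entryCell G x X Y i j) = entryCell G x' X' Y' i j)
    (h₂ : ∀ i, g (endCell x X Y i) = endCell x' X' Y' i) :
    (word G x X Y).map g = word G x' X' Y' := by
  simp [word, List.map_flatMap, ← List.map_eq_flatMap, Function.comp_def, h₁, h₂]

/-- A sweep over a concatenation of words, where `st i` is the register before the `i`-th. -/
lemma transduce_flatMap {σ Γ : Type} (δ : σ → Γ → σ × Γ) (st : ℕ → σ) (f g : Fin n → List Γ)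
    (h : ∀ i : Fin n, transduce δ (st i) (f i) = (st (i + 1), g i)) :
    transduce δ (st 0) ((List.finRange n).flatMap f) = (st n, (List.finRange n).flatMap g) := by
  induction n generalizing st with
  | zero => rfl
  | succ n ih =>
    have h0 := h 0
    have := ih (fun i => st (i + 1)) (fun i => f i.succ) (fun i => g i.succ) fun i => h i.succ
    simp only [Fin.val_zero, zero_add] at h0 this
    rw [List.finRange_succ, List.flatMap_cons, List.flatMap_cons, List.flatMap_map,
      List.flatMap_map, transduce_append, h0]
    simp [this]

/-! ### Elementary sweeps -/

/-- Tests whether some letter satisfies `P`. -/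
def anyProg (P : Cell ι → Bool) : Prog Reg (Cell ι) :=
  .seq (.load fun v => { v with res := false })
    (.sweep fun v c => ({ v with res := v.res || P c }, c))

lemma exec_anyProg (P : Cell ι → Bool) (v : Reg) (w : List (Cell ι)) :
    Exec (anyProg P) (v, w) (2 * w.length + 3) ({ v with res := w.any P }, w) := by
  have h : ∀ v : Reg, transduce (fun (v : Reg) c => ({ v with res := v.res || P c }, c)) v w =
      ({ v with res := v.res || w.any P }, w) := by
    induction w with
    | nil => intro v; simp [transduce]
    | cons a w ih => intro v; simp [transduce, ih, Bool.or_assoc]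
  have := Exec.seq (Exec.load (fun v : Reg => { v with res := false }) v w)
    (Exec.sweep (fun (v : Reg) c => ({ v with res := v.res || P c }, c)) _ w)
  rw [h] at this
  rw [show 2 * w.length + 3 = 1 + (2 * w.length + 2) by ring]
  simpa [anyProg] using this

/-- Rewrites each letter by a function that may depend on the register. -/
def mapProg (g : Reg → Cell ι → Cell ι) : Prog Reg (Cell ι) := .sweep fun v c => (v, g v c)

lemma exec_mapProg (g : Reg → Cell ι → Cell ι) (v : Reg) (w : List (Cell ι)) :
    Exec (mapProg g) (v, w) (2 * w.length + 2) (v, w.map (g v)) := by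
  have h : transduce (fun (v : Reg) c => (v, g v c)) v w = (v, w.map (g v)) := by
    induction w with
    | nil => rfl
    | cons a w ih => simp [transduce, ih]
  rw [← h]
  exact .sweep _ _ _

variable [DecidableEq ι]

/-- The transducer that moves the marks of the variable `a` one place forward. The bit `row` of the
register is the mark of the previous row, `col` that of the previous column, and `b` is moved in at
the start. -/
def shift (a : ι) (b : Bool) (v : Reg) (c : Cell ι) : Reg × Cell ι :=
  match c.kind with
  | some _ => ({ v with col := c.col a },
      { c with row := Function.update c.row a v.row, col := Function.update c.col a v.col })
  | none => ({ v with row := c.row a, col := b }, { c with row := Function.update c.row a v.row })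

/-- Moves the variable `a` to the next vertex, or, if `b` holds, from the unset state to the first
vertex. Afterwards the bit `row` tells whether the variable has run out of vertices. -/
def shiftProg (a : ι) (b : Bool) : Prog Reg (Cell ι) :=
  .seq (.load fun v => { v with row := b, col := b }) (.sweep (shift a b))

open Classical in
lemma transduce_shift (G : SimpleGraph (Fin n)) (x : ι → ℕ) (X Y : Fin n → Prop) (a : ι) (b : Bool)
    (hb : b = true → n ≤ x a) (y : ℕ) (hy : y = if b = true then 0 else x a + 1) (r : Bool) :
    transduce (shift a b) ⟨r, b, b⟩ (word G x X Y) =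
      (⟨r, decide (y = n), b⟩, word G (Function.update x a y) X Y) := by
  have hb0 : b = decide (y = 0) := by cases b <;> simp [hy]
  have hstep : ∀ i : Fin n, decide (x a = i) = decide (y = i + 1) := by
    intro i
    have := i.isLt
    cases b
    · simp [hy]
    · have := hb rfl
      simp only [hy, if_true, decide_eq_decide]
      omega
  have hrow : ∀ k : ℕ, (fun a' => decide (Function.update x a y a' = k)) =
      Function.update (fun a' => decide (x a' = k)) a (decide (y = k)) := by
    intro k
    funext a'
    by_cases h : a' = a
    · subst h; simp
    · simp [h]
  have h := transduce_flatMap (shift a b) (fun i => ⟨r, decide (y = i), b⟩)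
    (fun i => ((List.finRange n).flatMap fun j => [entryCell G x X Y i j]) ++ [endCell x X Y i])
    (fun i => ((List.finRange n).flatMap fun j =>
      [entryCell G (Function.update x a y) X Y i j]) ++ [endCell (Function.update x a y) X Y i])
    ?_
  · simpa [word, ← hb0] using h
  intro i
  have h := transduce_flatMap (shift a b) (fun j => ⟨r, decide (y = i), decide (y = j)⟩)
    (fun j => [entryCell G x X Y i j])
    (fun j => [entryCell G (Function.update x a y) X Y i j]) ?_
  · simp only [← hb0] at h
    rw [transduce_append, h]
    simp only [transduce, shift, endCell, hrow, hstep]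
  · intro j
    simp only [transduce, shift, entryCell, hrow, hstep]

lemma exec_shiftProg (G : SimpleGraph (Fin n)) (x : ι → ℕ) (X Y : Fin n → Prop) (a : ι) (b : Bool)
    (hb : b = true → n ≤ x a) (y : ℕ) (hy : y = if b = true then 0 else x a + 1) (v : Reg) :
    Exec (shiftProg a b) (v, word G x X Y) (2 * (n * (n + 1)) + 3)
      (⟨v.res, decide (y = n), b⟩, word G (Function.update x a y) X Y) := by
  have := Exec.seq (Exec.load (fun v : Reg => { v with row := b, col := b }) v (word G x X Y))
    (Exec.sweep (shift a b) _ _)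
  rw [transduce_shift G x X Y a b hb y hy] at this
  rw [length_word] at this
  rw [show 2 * (n * (n + 1)) + 3 = 1 + (2 * (n * (n + 1)) + 2) by ring]
  exact this

/-- Unsets the variable `a`. -/
def clearProg (a : ι) : Prog Reg (Cell ι) :=
  mapProg fun _ c => { c with
    row := Function.update c.row a false
    col := Function.update c.col a false }

lemma exec_clearProg (G : SimpleGraph (Fin n)) (x : ι → ℕ) (X Y : Fin n → Prop) (a : ι) (v : Reg) :
    Exec (clearProg a) (v, word G x X Y) (2 * (n * (n + 1)) + 2)
      (v, word G (Function.update x a n) X Y) := by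
  have := exec_mapProg (fun _ c => { c with
    row := Function.update c.row a false
    col := Function.update c.col a false }) v (word G x X Y)
  rw [length_word, map_word G x (Function.update x a n) X Y X Y] at this
  · exact this
  · intro i j
    simp only [entryCell]
    congr 1 <;> · funext a'; by_cases h : a' = a <;> simp [h, Nat.ne_of_gt]
  · intro i
    simp only [endCell]
    congr 1 <;> · funext a'; by_cases h : a' = a <;> simp [h, Nat.ne_of_gt]

end Words

/-! ### Loops over all vertices -/

section Loops

variable {ι : Type} [DecidableEq ι] {n : ℕ}

/-- Runs `p` for the values of the variable `a` in turn until the result is true. -/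
def exProg (a : ι) (p : Prog Reg (Cell ι)) : Prog Reg (Cell ι) :=
  .seq (.load fun _ => ⟨false, false, false⟩) <| .seq (shiftProg a true) <|
    .seq (.while (fun v => !v.row) <| .seq p <|
      .ite (fun v => v.res) (.load fun v => { v with row := true }) (shiftProg a false)) <|
    clearProg a

/-- Runs `p` for all values of the variable `a` in turn. -/
def forProg (a : ι) (p : Prog Reg (Cell ι)) : Prog Reg (Cell ι) :=
  .seq (shiftProg a true) <| .seq (.while (fun v => !v.row) <| .seq p <| shiftProg a false) <|
    clearProg a

lemma exec_shiftProg_true (G : SimpleGraph (Fin n)) {x : ι → ℕ} {X Y : Fin n → Prop} {a : ι}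
    (hx : x a = n) (v : Reg) :
    Exec (shiftProg a true) (v, word G x X Y) (2 * (n * (n + 1)) + 3)
      (⟨v.res, decide (0 = n), true⟩, word G (Function.update x a 0) X Y) :=
  exec_shiftProg G x X Y a true (fun _ => hx.ge) 0 rfl v

lemma exec_shiftProg_false (G : SimpleGraph (Fin n)) {x : ι → ℕ} {X Y : Fin n → Prop} {a : ι}
    (i : ℕ) (v : Reg) :
    Exec (shiftProg a false) (v, word G (Function.update x a i) X Y) (2 * (n * (n + 1)) + 3)
      (⟨v.res, decide (i + 1 = n), false⟩, word G (Function.update x a (i + 1)) X Y) := by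
  have := exec_shiftProg G (Function.update x a i) X Y a false (by simp) (i + 1) (by simp) v
  rwa [Function.update_idem] at this

lemma exec_clearProg_update (G : SimpleGraph (Fin n)) {x : ι → ℕ} {X Y : Fin n → Prop} {a : ι}
    (hx : x a = n) (i : ℕ) (v : Reg) :
    Exec (clearProg a) (v, word G (Function.update x a i) X Y) (2 * (n * (n + 1)) + 2)
      (v, word G x X Y) := by
  have := exec_clearProg G (Function.update x a i) X Y a v
  have hxa : Function.update x a n = x := by
    funext b
    by_cases h : b = a
    · subst h; simp [hx]
    · simp [h]
  rwa [Function.update_idem, hxa] at this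

open Classical in
lemma exec_exProg (G : SimpleGraph (Fin n)) {x : ι → ℕ} {X Y : Fin n → Prop} {a : ι} (hx : x a = n)
    {p : Prog Reg (Cell ι)} {T : ℕ} {P : Fin n → Prop}
    (hp : ∀ (i : Fin n) v, ∃ v' t, Exec p (v, word G (Function.update x a i) X Y) t
      (v', word G (Function.update x a i) X Y) ∧ v'.res = decide (P i) ∧ t ≤ T) (v : Reg) :
    ∃ v' t, Exec (exProg a p) (v, word G x X Y) t (v', word G x X Y) ∧
      v'.res = decide (∃ i, P i) ∧
      t ≤ n * (T + 2 * (n * (n + 1)) + 5) + 4 * (n * (n + 1)) + 7 := by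
  -- the loop, started at the vertex `k`, where `m` vertices are left
  have hloop : ∀ m k, k + m = n → ∀ v : Reg, v.res = false → v.row = decide (k = n) →
      ∃ v' t y, Exec (.while (fun v => !v.row) <| .seq p <|
        .ite (fun v => v.res) (.load fun v => { v with row := true }) (shiftProg a false))
          (v, word G (Function.update x a k) X Y) t (v', word G (Function.update x a y) X Y) ∧
        v'.res = decide (∃ i : Fin n, k ≤ i ∧ P i) ∧
        t ≤ m * (T + 2 * (n * (n + 1)) + 5) + 1 := by
    intro m
    induction m with
    | zero =>
      intro k hk v hres hrow
      refine ⟨v, 1, k, .while_false (by simp [hrow, ← hk]), ?_, by simp⟩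
      have : ¬ ∃ i : Fin n, k ≤ i ∧ P i := by rintro ⟨i, hi, -⟩; have := i.isLt; omega
      simp [hres, this]
    | succ m ih =>
      intro k hk v hres hrow
      have hkn : k < n := by omega
      obtain ⟨v₁, t₁, h₁, hr₁, ht₁⟩ := hp ⟨k, hkn⟩ v
      by_cases hP : P ⟨k, hkn⟩
      · refine ⟨⟨v₁.res, true, v₁.col⟩, _, k, .while_true (by simp [hrow, hkn.ne])
          (.seq h₁ (.ite_true (by simp [hr₁, hP]) (.load _ _ _))) (.while_false (by simp)), ?_, ?_⟩
        · have : ∃ i : Fin n, k ≤ i ∧ P i := ⟨⟨k, hkn⟩, le_rfl, hP⟩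
          simp [this, hr₁, hP]
        · rw [Nat.succ_mul m]; omega
      · obtain ⟨v₂, t₂, y, h₂, hr₂, ht₂⟩ := ih (k + 1) (by omega)
          ⟨v₁.res, decide (k + 1 = n), false⟩ (by simp [hr₁, hP]) rfl
        refine ⟨v₂, _, y, .while_true (by simp [hrow, hkn.ne])
          (.seq h₁ (.ite_false (by simp [hr₁, hP]) (exec_shiftProg_false G k v₁))) h₂, ?_, ?_⟩
        · rw [hr₂, decide_eq_decide]
          constructor
          · rintro ⟨i, hi, h⟩; exact ⟨i, by omega, h⟩
          · rintro ⟨i, hi, h⟩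
            refine ⟨i, ?_, h⟩
            rcases hi.lt_or_eq with hi | hi
            · exact hi
            · exact absurd (by simpa [hi] using h) hP
        · rw [Nat.succ_mul m]; omega
  obtain ⟨v', t, y, h, hr, ht⟩ := hloop n 0 (by simp) ⟨false, decide (0 = n), true⟩ rfl rfl
  refine ⟨v', _, .seq (.load _ _ _) (.seq (exec_shiftProg_true G hx _) (.seq h
    (exec_clearProg_update G hx y _))), by simp [hr], ?_⟩
  omega

lemma exec_forProg (G : SimpleGraph (Fin n)) {x : ι → ℕ} {a : ι} (hx : x a = n)
    {p : Prog Reg (Cell ι)} {T : ℕ} (X Y : ℕ → Fin n → Prop)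
    (hp : ∀ (i : Fin n) v, ∃ v' t, Exec p (v, word G (Function.update x a i) (X i) (Y i)) t
      (v', word G (Function.update x a i) (X (i + 1)) (Y (i + 1))) ∧ t ≤ T) (v : Reg) :
    ∃ v' t, Exec (forProg a p) (v, word G x (X 0) (Y 0)) t (v', word G x (X n) (Y n)) ∧
      t ≤ n * (T + 2 * (n * (n + 1)) + 5) + 4 * (n * (n + 1)) + 7 := by
  have hloop : ∀ m k, k + m = n → ∀ v : Reg, v.row = decide (k = n) →
      ∃ v' t, Exec (.while (fun v => !v.row) <| .seq p <| shiftProg a false)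
          (v, word G (Function.update x a k) (X k) (Y k)) t
          (v', word G (Function.update x a n) (X n) (Y n)) ∧
        t ≤ m * (T + 2 * (n * (n + 1)) + 5) + 1 := by
    intro m
    induction m with
    | zero =>
      intro k hk v hrow
      obtain rfl : k = n := by omega
      exact ⟨v, 1, .while_false (by simp [hrow]), by simp⟩
    | succ m ih =>
      intro k hk v hrow
      have hkn : k < n := by omega
      obtain ⟨v₁, t₁, h₁, ht₁⟩ := hp ⟨k, hkn⟩ v
      obtain ⟨v₂, t₂, h₂, ht₂⟩ := ih (k + 1) (by omega) ⟨v₁.res, decide (k + 1 = n), false⟩ rfl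
      refine ⟨v₂, _, .while_true (by simp [hrow, hkn.ne])
        (.seq h₁ (exec_shiftProg_false G k v₁)) h₂, ?_⟩
      rw [Nat.succ_mul m]; omega
  obtain ⟨v', t, h, ht⟩ := hloop n 0 (by simp) ⟨v.res, decide (0 = n), true⟩ rfl
  refine ⟨v', _, .seq (exec_shiftProg_true G hx _) (.seq h (exec_clearProg_update G hx n _)), ?_⟩
  omega

end Loops

/-! ### First-order formulas -/

/-- First-order formulas over a graph with a distinguished set of vertices, with variables named
by `ι`. -/
inductive Fml (ι : Type) where
  | adj (a b : ι)
  | eq (a b : ι)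
  | mem (a : ι)
  | neg (φ : Fml ι)
  | and (φ ψ : Fml ι)
  | ex (a : ι) (φ : Fml ι)

namespace Fml

variable {ι : Type} [DecidableEq ι] {n : ℕ}

/-- Truth of a formula under a valuation of the variables; atoms with unset variables are false. -/
def Sat (G : SimpleGraph (Fin n)) (X : Fin n → Prop) : Fml ι → (ι → ℕ) → Prop
  | adj a b, x => ∃ i j : Fin n, x a = i ∧ x b = j ∧ G.Adj i j
  | eq a b, x => ∃ i : Fin n, x a = i ∧ x b = i
  | mem a, x => ∃ i : Fin n, x a = i ∧ X i
  | neg φ, x => ¬ φ.Sat G X x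
  | and φ ψ, x => φ.Sat G X x ∧ ψ.Sat G X x
  | ex a φ, x => ∃ i : Fin n, φ.Sat G X (Function.update x a i)

/-- No quantifier binds a variable of `s` or one that is already bound. -/
def WellScoped : Finset ι → Fml ι → Prop
  | s, neg φ => φ.WellScoped s
  | s, and φ ψ => φ.WellScoped s ∧ ψ.WellScoped s
  | s, ex a φ => a ∉ s ∧ φ.WellScoped (insert a s)
  | _, _ => True

/-- The program that evaluates a formula. -/
def check : Fml ι → Prog Reg (Cell ι)
  | adj a b => anyProg fun c => c.row a && c.col b && c.kind.getD false
  | eq a b => anyProg fun c => c.row a && c.row b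
  | mem a => anyProg fun c => c.row a && c.cur
  | neg φ => .seq φ.check (.load fun v => { v with res := !v.res })
  | and φ ψ => .seq φ.check (.ite (fun v => v.res) ψ.check (.load id))
  | ex a φ => exProg a φ.check

open Polynomial in
/-- A bound on the number of steps of a loop over all vertices, in terms of the length of the word,
where `T` bounds those of one round. -/
noncomputable def loopTime (T : ℕ[X]) : ℕ[X] := X * (T + 2 * X + 5) + 4 * X + 7

lemma le_eval_loopTime {t T : ℕ} {P : Polynomial ℕ} (hP : T ≤ P.eval (n * (n + 1)))
    (ht : t ≤ n * (T + 2 * (n * (n + 1)) + 5) + 4 * (n * (n + 1)) + 7) :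
    t ≤ (loopTime P).eval (n * (n + 1)) := by
  have hn : n ≤ n * (n + 1) := Nat.le_mul_of_pos_right n n.succ_pos
  simp only [loopTime, Polynomial.eval_add, Polynomial.eval_mul, Polynomial.eval_X,
    Polynomial.eval_ofNat]
  refine ht.trans ?_
  gcongr

open Polynomial in
/-- A bound on the number of steps of `check`, in terms of the length of the word. -/
noncomputable def time : Fml ι → ℕ[X]
  | neg φ => φ.time + 1
  | and φ ψ => φ.time + ψ.time + 2
  | ex _ φ => loopTime φ.time
  | _ => 2 * X + 3

open Classical in
lemma exec_anyProg_word {ι : Type} (G : SimpleGraph (Fin n)) (x : ι → ℕ) (X Y : Fin n → Prop)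
    (P : Cell ι → Bool) (Q : Prop) (v : Reg) (hPQ : (word G x X Y).any P = true ↔ Q) :
    ∃ v' t, Exec (anyProg P) (v, word G x X Y) t (v', word G x X Y) ∧
      v'.res = decide Q ∧ t ≤ (2 * Polynomial.X + 3 : Polynomial ℕ).eval (n * (n + 1)) := by
  refine ⟨_, _, exec_anyProg P v _, ?_, ?_⟩
  · rw [Bool.eq_iff_iff, hPQ, decide_eq_true_eq]
  · simp [length_word]

open Classical in
/-- The program `check` decides the truth of a formula, in polynomial time. -/
lemma exec_check (G : SimpleGraph (Fin n)) (X Y : Fin n → Prop) (φ : Fml ι) (s : Finset ι)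
    (hφ : φ.WellScoped s) (x : ι → ℕ) (hx : ∀ a ∉ s, x a = n) (v : Reg) :
    ∃ v' t, Exec φ.check (v, word G x X Y) t (v', word G x X Y) ∧
      v'.res = decide (φ.Sat G X x) ∧ t ≤ φ.time.eval (n * (n + 1)) := by
  induction φ generalizing s x v with
  | adj a b =>
    refine exec_anyProg_word G x X Y _ _ v ?_
    rw [any_word]
    simp [entryCell, endCell, Sat, and_assoc]
  | eq a b =>
    refine exec_anyProg_word G x X Y _ _ v ?_
    rw [any_word]
    simp only [entryCell, endCell, Sat, Bool.and_eq_true, decide_eq_true_eq]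
    exact exists_congr fun i => ⟨fun h => h.elim (fun h => h.choose_spec) id, .inr⟩
  | mem a =>
    refine exec_anyProg_word G x X Y _ _ v ?_
    rw [any_word]
    simp only [entryCell, endCell, Sat, Bool.and_eq_true, decide_eq_true_eq]
    exact exists_congr fun i => ⟨fun h => h.elim (fun h => h.choose_spec) id, .inr⟩
  | neg φ ih =>
    obtain ⟨v', t, h, hr, ht⟩ := ih s hφ x hx v
    refine ⟨_, _, .seq h (.load _ _ _), ?_, ?_⟩
    · by_cases hs : φ.Sat G X x <;> simp [Sat, hr, hs]
    · simpa [time] using ht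
  | and φ ψ ihφ ihψ =>
    obtain ⟨v₁, t₁, h₁, hr₁, ht₁⟩ := ihφ s hφ.1 x hx v
    obtain ⟨v₂, t₂, h₂, hr₂, ht₂⟩ := ihψ s hφ.2 x hx v₁
    by_cases hs : φ.Sat G X x
    · refine ⟨v₂, _, .seq h₁ (.ite_true (by simp [hr₁, hs]) h₂), by simp [Sat, hs, hr₂], ?_⟩
      simp [time]; omega
    · refine ⟨v₁, _, .seq h₁ (.ite_false (by simp [hr₁, hs]) (.load _ _ _)),
        by simp [Sat, hs, hr₁], ?_⟩
      simp [time]; omega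
  | ex a φ ih =>
    obtain ⟨v', t, h, hr, ht⟩ := exec_exProg G (hx a hφ.1) (X := X) (Y := Y) (p := φ.check)
      (fun i v => ih (insert a s) hφ.2 (Function.update x a i) (fun b hb => by
        rw [Finset.mem_insert, not_or] at hb
        rw [Function.update_of_ne hb.1, hx b hb.2]) v) v
    exact ⟨v', t, h, by rw [hr, decide_eq_decide]; rfl, le_eval_loopTime le_rfl ht⟩

/-! ### Iterating a formula -/

/-- Replaces the set of vertices by the set of those values of `a` for which `φ` holds. -/
def roundProg (φ : Fml ι) (a : ι) : Prog Reg (Cell ι) :=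
  .seq (forProg a <| .seq φ.check <|
      mapProg fun v c => { c with next := bif c.row a then v.res else c.next }) <|
    mapProg fun _ c => { c with cur := c.next }

/-- Runs `roundProg` as often as there are vertices; the variable `t` counts the rounds. -/
def iterProg (φ : Fml ι) (a t : ι) : Prog Reg (Cell ι) := forProg t (roundProg φ a)

lemma exec_iterProg (G : SimpleGraph (Fin n)) (φ : Fml ι) (a t : ι) (hat : a ≠ t)
    (hφ : φ.WellScoped {a, t}) (F : (Fin n → Prop) → Fin n → Prop)
    (hF : ∀ X (i : Fin n) (k : ℕ), φ.Sat G X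
      (Function.update (Function.update (fun _ => n) t k) a i) ↔ F X i) (v : Reg) :
    ∃ v' T, Exec (iterProg φ a t) (v, word G (fun _ => n) (fun _ => False) fun _ => False) T
        (v', word G (fun _ => n) (F^[n] fun _ => False) (F^[n] fun _ => False)) ∧
      T ≤ (loopTime (loopTime (φ.time + 2 * Polynomial.X + 2) + 2 * Polynomial.X + 2)).eval
        (n * (n + 1)) := by
  classical
  let S : ℕ → Fin n → Prop := fun k => F^[k] fun _ => False
  have hround : ∀ (k : Fin n) v, ∃ v' T, Exec (roundProg φ a)
      (v, word G (Function.update (fun _ => n) t k) (S k) (S k)) T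
      (v', word G (Function.update (fun _ => n) t k) (S (k + 1)) (S (k + 1))) ∧
      T ≤ (loopTime (φ.time + 2 * Polynomial.X + 2) + 2 * Polynomial.X + 2).eval
        (n * (n + 1)) := by
    intro k v
    set x : ι → ℕ := Function.update (fun _ => n) t k
    -- the next set where the vertices below `i` have been treated
    let Y : ℕ → Fin n → Prop := fun i j => if (j : ℕ) < i then S (k + 1) j else S k j
    have hvertex : ∀ (i : Fin n) v, ∃ v' T, Exec (.seq φ.check <|
          mapProg fun v c => { c with next := bif c.row a then v.res else c.next })
        (v, word G (Function.update x a i) (S k) (Y i)) T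
        (v', word G (Function.update x a i) (S k) (Y (i + 1))) ∧
        T ≤ (φ.time + 2 * Polynomial.X + 2).eval (n * (n + 1)) := by
      intro i v
      obtain ⟨v', T, h, hr, hT⟩ := exec_check G (S k) (Y i) φ {a, t} hφ (Function.update x a i)
        (by
          intro b hb
          simp only [Finset.mem_insert, Finset.mem_singleton, not_or] at hb
          simp [x, hb.1, hb.2]) v
      have hY : ∀ j : Fin n, decide (Y (i + 1) j) =
          bif decide ((i : ℕ) = j) then v'.res else decide (Y i j) := by
        intro j
        rw [hr, hF]
        rcases lt_trichotomy (i : ℕ) j with hij | hij | hij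
        · have h1 : ¬ (j : ℕ) < i + 1 := by omega
          have h2 : ¬ (j : ℕ) < i := by omega
          simp [Y, hij.ne, h1, h2]
        · obtain rfl : i = j := Fin.ext hij
          simp [Y, S, Function.iterate_succ_apply']
        · have h1 : (j : ℕ) < i + 1 := by omega
          simp [Y, hij.ne', h1, hij]
      have h' := h.seq (exec_mapProg (fun v c =>
        { c with next := bif c.row a then v.res else c.next }) _ _)
      rw [map_word G (Function.update x a i) (Function.update x a i) (S k) (Y i) (S k)
          (Y (i + 1)) _ (fun i' j => by
            simp only [entryCell, Function.update_self]; congr 1; convert (hY i').symm)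
          (fun i' => by
            simp only [endCell, Function.update_self]; congr 1; convert (hY i').symm)] at h'
      refine ⟨v', _, h', ?_⟩
      rw [length_word]
      simp only [Polynomial.eval_add, Polynomial.eval_mul, Polynomial.eval_X,
        Polynomial.eval_ofNat]
      omega
    obtain ⟨v', T, h, hT⟩ := exec_forProg G (x := x) (a := a) (by simp [x, hat])
      (fun _ => S k) Y hvertex v
    have hY0 : Y 0 = S k := by funext j; simp [Y]
    have hYn : Y n = S (k + 1) := by funext j; simp [Y]
    rw [hY0, hYn] at h
    have h' := h.seq (exec_mapProg (fun _ c => { c with cur := c.next }) _ _)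
    rw [map_word G x x (S k) (S (k + 1)) (S (k + 1)) (S (k + 1)) _
      (fun i j => rfl) (fun i => rfl)] at h'
    refine ⟨v', _, h', ?_⟩
    rw [length_word]
    have := le_eval_loopTime le_rfl hT
    simp only [Polynomial.eval_add, Polynomial.eval_mul, Polynomial.eval_X,
      Polynomial.eval_ofNat] at this ⊢
    omega
  obtain ⟨v', T, h, hT⟩ := exec_forProg G (x := fun _ : ι => n) (a := t) rfl S S hround v
  exact ⟨v', T, h, le_eval_loopTime le_rfl hT⟩

end Fml

end SweepProgram

namespace MBDomination

open SweepProgram Fml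

/-! ### The outcome as a polynomial-time function -/

/-- The disjunction of two formulas. -/
def fmlOr {ι : Type} (φ ψ : Fml ι) : Fml ι := .neg (.and (.neg φ) (.neg ψ))

/-- The implication between two formulas. -/
def fmlImp {ι : Type} (φ ψ : Fml ι) : Fml ι := .neg (.and φ (.neg ψ))

/-- The universal quantification of a formula. -/
def fmlAll {ι : Type} (a : ι) (φ : Fml ι) : Fml ι := .neg (.ex a (.neg φ))

/-- The formula for `InClosedNbhd G a b`. -/
def fmlNbhd (a b : Fin 6) : Fml (Fin 6) := fmlOr (.eq a b) (.adj b a)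

/-- The formula for `Below G a b`, for free variables other than `5`. -/
def fmlBelow (a b : Fin 6) : Fml (Fin 6) :=
  .and (.adj a b) (.and (fmlAll 5 (fmlImp (fmlNbhd 5 a) (fmlNbhd 5 b)))
    (.ex 5 (.and (fmlNbhd 5 b) (.neg (fmlNbhd 5 a)))))

/-- The formula for `CoveredBy G a b`, for free variables other than `4` and `5`. -/
def fmlCovered (a b : Fin 6) : Fml (Fin 6) :=
  .and (fmlBelow a b) (fmlAll 4 (fmlImp (fmlBelow a 4) (.neg (fmlBelow 4 b))))

/-- The formula for `MarkStep` at the variable `0`. -/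
def fmlMarkStep : Fml (Fin 6) :=
  .and (fmlAll 1 (fmlImp (.adj 1 0) (fmlOr (fmlBelow 1 0) (fmlBelow 0 1))))
    (fmlOr (fmlAll 1 (.neg (fmlBelow 1 0)))
      (.ex 1 (.ex 2 (.and (.neg (.eq 1 2))
        (.and (.and (fmlCovered 1 0) (.mem 1)) (.and (fmlCovered 2 0) (.mem 2)))))))

/-- The formula for `IsRoot` at the variable `a`, where the set holds the marked vertices. -/
def fmlRoot (a : Fin 6) : Fml (Fin 6) := .and (.mem a) (fmlAll 4 (.neg (fmlBelow a 4)))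

/-- The formula for `HasRoot`. -/
def fmlHasRoot : Fml (Fin 6) := .ex 1 (fmlRoot 1)

/-- The formula for `HasTwoRoots`. -/
def fmlHasTwoRoots : Fml (Fin 6) :=
  .ex 1 (.ex 2 (.and (.neg (.eq 1 2)) (.and (fmlRoot 1) (fmlRoot 2))))

section

variable {n : ℕ} {G : SimpleGraph (Fin n)} {X : Fin n → Prop}

@[simp] lemma sat_fmlOr {ι : Type} [DecidableEq ι] {φ ψ : Fml ι} {x : ι → ℕ} :
    (fmlOr φ ψ).Sat G X x ↔ φ.Sat G X x ∨ ψ.Sat G X x := by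
  simp only [fmlOr, Sat]; tauto

@[simp] lemma sat_fmlImp {ι : Type} [DecidableEq ι] {φ ψ : Fml ι} {x : ι → ℕ} :
    (fmlImp φ ψ).Sat G X x ↔ (φ.Sat G X x → ψ.Sat G X x) := by
  simp only [fmlImp, Sat]; tauto

@[simp] lemma sat_fmlAll {ι : Type} [DecidableEq ι] {a : ι} {φ : Fml ι} {x : ι → ℕ} :
    (fmlAll a φ).Sat G X x ↔ ∀ i : Fin n, φ.Sat G X (Function.update x a i) := by
  simp [fmlAll, Sat]

variable {x : Fin 6 → ℕ} {a b : Fin 6} {i j : Fin n}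

lemma sat_adj (ha : x a = i) (hb : x b = j) : (Fml.adj a b).Sat G X x ↔ G.Adj i j := by
  simp [Sat, ha, hb, Fin.val_inj]

lemma sat_eq (ha : x a = i) (hb : x b = j) : (Fml.eq a b).Sat G X x ↔ i = j := by
  simp [Sat, ha, hb, Fin.val_inj, eq_comm]

lemma sat_mem (ha : x a = i) : (Fml.mem a).Sat G X x ↔ X i := by
  simp [Sat, ha, Fin.val_inj]

lemma sat_fmlNbhd (ha : x a = i) (hb : x b = j) :
    (fmlNbhd a b).Sat G X x ↔ InClosedNbhd G i j := by
  rw [fmlNbhd, sat_fmlOr, sat_eq ha hb, sat_adj hb ha, InClosedNbhd]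

lemma sat_fmlBelow (ha : x a = i) (hb : x b = j) (ha5 : a ≠ 5) (hb5 : b ≠ 5) :
    (fmlBelow a b).Sat G X x ↔ Below G i j := by
  have ha' : ∀ k : ℕ, Function.update x 5 k a = i := fun k => by simp [ha5, ha]
  have hb' : ∀ k : ℕ, Function.update x 5 k b = j := fun k => by simp [hb5, hb]
  have h5 : ∀ k : Fin n, Function.update x 5 (k : ℕ) 5 = k := fun k => by simp
  simp only [fmlBelow, Sat, sat_fmlAll, sat_fmlImp, sat_fmlNbhd (h5 _) (ha' _),
    sat_fmlNbhd (h5 _) (hb' _), Below]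
  simp [ha, hb, Fin.val_inj]

lemma sat_fmlCovered (ha : x a = i) (hb : x b = j) (ha5 : a ≠ 5) (hb5 : b ≠ 5) (ha4 : a ≠ 4)
    (hb4 : b ≠ 4) : (fmlCovered a b).Sat G X x ↔ CoveredBy G i j := by
  have ha' : ∀ k : ℕ, Function.update x 4 k a = i := fun k => by simp [ha4, ha]
  have hb' : ∀ k : ℕ, Function.update x 4 k b = j := fun k => by simp [hb4, hb]
  have h4 : ∀ k : Fin n, Function.update x 4 (k : ℕ) 4 = k := fun k => by simp
  simp only [fmlCovered, Sat, sat_fmlAll, sat_fmlImp, sat_fmlBelow ha hb ha5 hb5, CoveredBy,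
    sat_fmlBelow (ha' _) (h4 _) ha5 (by decide), sat_fmlBelow (h4 _) (hb' _) (by decide) hb5]

lemma sat_fmlRoot (ha : x a = i) (ha5 : a ≠ 5) (ha4 : a ≠ 4) :
    (fmlRoot a).Sat G X x ↔ X i ∧ ∀ w, ¬ Below G i w := by
  have ha' : ∀ k : ℕ, Function.update x 4 k a = i := fun k => by simp [ha4, ha]
  have h4 : ∀ k : Fin n, Function.update x 4 (k : ℕ) 4 = k := fun k => by simp
  rw [fmlRoot, Sat, sat_mem ha]
  simp only [Sat, sat_fmlAll, sat_fmlBelow (ha' _) (h4 _) ha5 (by decide)]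

lemma sat_fmlMarkStep (h0 : x 0 = i) : fmlMarkStep.Sat G X x ↔ MarkStep G X i := by
  have h0' : ∀ k : ℕ, Function.update x 1 k 0 = i := fun k => by simp [h0]
  have h1 : ∀ k : Fin n, Function.update x 1 (k : ℕ) 1 = k := fun k => by simp
  have h0'' : ∀ k l : ℕ, Function.update (Function.update x 1 k) 2 l 0 = i := fun k l => by
    simp [h0]
  have h1'' : ∀ (k : Fin n) (l : ℕ), Function.update (Function.update x 1 (k : ℕ)) 2 l 1 = k :=
    fun k l => by simp
  have h2'' : ∀ (k : ℕ) (l : Fin n), Function.update (Function.update x 1 k) 2 (l : ℕ) 2 = l :=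
    fun k l => by simp
  have hA : ∀ k : Fin n, (Fml.adj 1 0).Sat G X (Function.update x 1 (k : ℕ)) ↔ G.Adj k i :=
    fun k => sat_adj (h1 k) (h0' k)
  have hE : ∀ k l : Fin n, (Fml.neg (.eq 1 2)).Sat G X
      (Function.update (Function.update x 1 (k : ℕ)) 2 (l : ℕ)) ↔ k ≠ l :=
    fun k l => not_congr (sat_eq (h1'' k l) (h2'' k l))
  have hM₁ : ∀ k l : Fin n, (Fml.mem 1).Sat G X
      (Function.update (Function.update x 1 (k : ℕ)) 2 (l : ℕ)) ↔ X k :=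
    fun k l => sat_mem (h1'' k l)
  have hM₂ : ∀ k l : Fin n, (Fml.mem 2).Sat G X
      (Function.update (Function.update x 1 (k : ℕ)) 2 (l : ℕ)) ↔ X l :=
    fun k l => sat_mem (h2'' k l)
  have hC₁ : ∀ k l : Fin n, (fmlCovered 1 0).Sat G X
      (Function.update (Function.update x 1 (k : ℕ)) 2 (l : ℕ)) ↔ CoveredBy G k i :=
    fun k l => sat_fmlCovered (h1'' k l) (h0'' k l) (by decide) (by decide) (by decide) (by decide)
  have hC₂ : ∀ k l : Fin n, (fmlCovered 2 0).Sat G X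
      (Function.update (Function.update x 1 (k : ℕ)) 2 (l : ℕ)) ↔ CoveredBy G l i :=
    fun k l => sat_fmlCovered (h2'' k l) (h0'' k l) (by decide) (by decide) (by decide) (by decide)
  have hB₁ : ∀ k : Fin n, (fmlBelow 1 0).Sat G X (Function.update x 1 (k : ℕ)) ↔ Below G k i :=
    fun k => sat_fmlBelow (h1 k) (h0' k) (by decide) (by decide)
  have hB₂ : ∀ k : Fin n, (fmlBelow 0 1).Sat G X (Function.update x 1 (k : ℕ)) ↔ Below G i k :=
    fun k => sat_fmlBelow (h0' k) (h1 k) (by decide) (by decide)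
  refine and_congr ?_ ?_
  · simp only [sat_fmlAll, sat_fmlImp, sat_fmlOr, hA, hB₁, hB₂]
  · rw [sat_fmlOr]
    refine or_congr ?_ ?_
    · rw [sat_fmlAll]
      exact forall_congr' fun k => not_congr (hB₁ k)
    · exact exists_congr fun k => exists_congr fun l => and_congr (hE k l)
        (and_congr (and_congr (hC₁ k l) (hM₁ k l)) (and_congr (hC₂ k l) (hM₂ k l)))

lemma sat_fmlHasRoot (x : Fin 6 → ℕ) (k : ℕ) : fmlHasRoot.Sat G (Marked G k) x ↔ HasRoot G k :=
  exists_congr fun i => sat_fmlRoot (i := i) (by simp) (by decide) (by decide)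

lemma sat_fmlHasTwoRoots (x : Fin 6 → ℕ) (k : ℕ) :
    fmlHasTwoRoots.Sat G (Marked G k) x ↔ HasTwoRoots G k :=
  exists_congr fun i => exists_congr fun j =>
    and_congr (not_congr (sat_eq (i := i) (j := j) (by simp) (by simp)))
      (and_congr (sat_fmlRoot (i := i) (by simp) (by decide) (by decide))
        (sat_fmlRoot (i := j) (by simp) (by decide) (by decide)))

end

/-- The program that computes the outcome: it marks vertices in `n` rounds and counts the roots.
The variable `3` counts the rounds. -/
def outcomeProg : Prog Reg (Cell (Fin 6)) :=
  .seq (iterProg fmlMarkStep 0 3) <| .seq fmlHasTwoRoots.check <|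
    .ite (fun v => v.res) (.load fun v => { v with row := true }) <|
    .seq fmlHasRoot.check (.load fun v => { v with row := false })

/-- The outcome encoded in the register when `outcomeProg` stops. -/
def outcomeOfReg (v : Reg) : Outcome := if v.res then (if v.row then .S else .N) else .D

/-- A bound on the number of steps of `outcomeProg`, in terms of the length of the word. -/
noncomputable def outcomeTime : Polynomial ℕ :=
  loopTime (loopTime (fmlMarkStep.time + 2 * Polynomial.X + 2) + 2 * Polynomial.X + 2) +
    fmlHasTwoRoots.time + fmlHasRoot.time + 2

lemma exec_outcomeProg {n : ℕ} (G : SimpleGraph (Fin n)) (v : Reg) :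
    ∃ t s, Exec outcomeProg (v, (encodeGraph G).map blankCell) t s ∧
      outcomeOfReg s.1 = rootOutcome G n ∧ t ≤ outcomeTime.eval (n * (n + 1)) := by
  classical
  rw [map_blankCell_encodeGraph]
  obtain ⟨v₁, t₁, h₁, ht₁⟩ := exec_iterProg G fmlMarkStep 0 3 (by decide)
    (by simp [fmlMarkStep, fmlAll, fmlImp, fmlOr, fmlBelow, fmlNbhd, fmlCovered, WellScoped])
    (MarkStep G) (fun X i k => sat_fmlMarkStep (by simp)) v
  obtain ⟨v₂, t₂, h₂, hr₂, ht₂⟩ := exec_check G (Marked G n) (Marked G n) fmlHasTwoRoots ∅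
    (by simp [fmlHasTwoRoots, fmlRoot, fmlAll, fmlImp, fmlOr, fmlBelow, fmlNbhd, WellScoped])
    (fun _ => n) (fun _ _ => rfl) v₁
  replace hr₂ : v₂.res = true ↔ HasTwoRoots G n := by
    rw [hr₂, decide_eq_true_eq, sat_fmlHasTwoRoots]
  obtain ⟨v₃, t₃, h₃, hr₃, ht₃⟩ := exec_check G (Marked G n) (Marked G n) fmlHasRoot ∅
    (by simp [fmlHasRoot, fmlRoot, fmlAll, fmlImp, fmlOr, fmlBelow, fmlNbhd, WellScoped])
    (fun _ => n) (fun _ _ => rfl) v₂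
  replace hr₃ : v₃.res = true ↔ HasRoot G n := by
    rw [hr₃, decide_eq_true_eq, sat_fmlHasRoot]
  have ht : t₁ + t₂ + t₃ + 2 ≤ outcomeTime.eval (n * (n + 1)) := by
    simp only [outcomeTime, Polynomial.eval_add, Polynomial.eval_ofNat] at ht₁ ⊢
    omega
  by_cases h : HasTwoRoots G n
  · refine ⟨_, _, .seq h₁ (.seq h₂ (.ite_true (by simp [hr₂, h]) (.load _ _ _))), ?_, by omega⟩
    simp [outcomeOfReg, rootOutcome, h, hr₂]
  · refine ⟨_, _, .seq h₁ (.seq h₂ (.ite_false (Bool.eq_false_iff.2 (mt hr₂.1 h)) (.seq h₃ (.load _ _ _)))), ?_,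
      by omega⟩
    simp [outcomeOfReg, rootOutcome, h, hr₃]

lemma length_encodeGraph {n : ℕ} (G : SimpleGraph (Fin n)) :
    (encodeGraph G).length = n * (n + 1) := by
  simp [encodeGraph]

/-- The outcome of cographs is computable in polynomial time. -/
theorem outcome_computableInPolyTime : Nonempty (Turing.TM2ComputableInPolyTime
    encodeInstance encodeOutcome (fun G : CographInstance => outcome G.1.2)) := by
  refine computableInPolyTime (p := outcomeProg) (v₀ := ⟨false, false, false⟩) (cell := blankCell)
    (res := outcomeOfReg) outcomeTime fun G => ?_
  obtain ⟨t, s, h, hs, ht⟩ := exec_outcomeProg G.1.2 ⟨false, false, false⟩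
  refine ⟨t, s, h, ?_, ?_⟩
  · rw [hs, outcome_eq_rootOutcome G.1.2 G.2]
  · rwa [encodeInstance, length_encodeGraph]

end MBDomination

theorem mainTheorem4 :
    (∀ {V : Type*} (G : SimpleGraph V) (t : MBDomination.Cotree),
      Nonempty (G ≃g t.graph) → MBDomination.outcome G = t.eval) ∧
    Nonempty (Turing.TM2ComputableInPolyTime
      MBDomination.encodeInstance MBDomination.encodeOutcome
      (fun G : MBDomination.CographInstance => MBDomination.outcome G.1.2)) :=
  ⟨fun G t ⟨e⟩ => MBDomination.outcome_eq_eval G t e, MBDomination.outcome_computableInPolyTime⟩
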